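/- **Conventions.** A unital pre-$C^*$-algebra $\mathcal A$ is a unital complex $*$-algebra with a (not necessarily complete) $C^*$-norm; it is moreover assumed to be a locally convex topological $*$-algebra for a topology finer than the norm topology. For a self-adjoint operator $D$ on a Hilbert space put $W^\infty(D)=\bigcap_n \mathrm{Dom}(D^n)$, with the Fréchet topology of the seminorms $h\mapsto\|D^nh\|$, and $W^1(D)=\mathrm{Dom}(D)$. For a dense subspace $\mathcal H$ of a Hilbert space $H$, $B(\mathcal H)=\{T\in B(H): T\mathcal H\subset\mathcal H,\ T^*\mathcal H\subset\mathcal H\}$. A *unital spectral triple* $\sigma=(\mathcal A,\mathcal H,D)$ consists of such an $\mathcal A$, a pre-Hilbert space $\mathcal H$ with completion $H$, a norm-continuous unital $*$-representation $\mathcal A\to B(\mathcal H)$, and a self-adjoint operator $D$ on $H$ with compact resolvent such that $W^\infty(D)=\mathcal H$, $[D,a]$ is norm-bounded on $\mathcal H$ for each $a\in\mathcal A$, and $\mathcal A\times\mathcal H\to\mathcal H$ is jointly continuous. It is *even* if it is equipped with a self-adjoint grading $\gamma$, $\gamma^2=1$, commuting with $\mathcal A$ and anticommuting with $D$, and *odd*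 if it is equipped with no grading. A *finite Kasparov $\mathcal B$-$\mathcal A$-module* is a unital $\mathcal B$-$\mathcal A$-bimodule $\mathcal E$ with an $\mathcal A$-valued positive definite inner product (linear in the second variable) which, as a right $\mathcal A$-module, is unitarily isomorphic to $p\mathcal A^n$ for some projection $p\in M_n(\mathcal A)$, has the topology induced from the locally convex topology of $\mathcal A$, and for which $\mathcal B\to B_{\mathcal A}(\mathcal E)$ is $*$-preserving and norm-continuous and $\mathcal B\times\mathcal E\to\mathcal E$ is jointly continuous. The conjugate $\mathcal A$-$\mathcal B$-bimodule is $\mathcal E^*=\{f_x=(x,\cdot): x\in\mathcal E\}$ with $af_x=f_{xa^*}$ and $f_xb=f_{b^*x}$. An *equivalence bimodule* is a finite Kasparov $\mathcal B$-$\mathcal A$-module $\mathcal E$ together with a $\mathcal B$-valued inner product making $\mathcal E^*$ a finite Kasparov $\mathcal A$-$\mathcal B$-module, such that $(f_x,f_y)\,z=x\,(y,z)$ for $x,y,z\in\mathcal E$ and both inner products are full (their values span $\mathcal A$, respectively $\mathcal B$). A *$\sigma$-connection* on $\mathcal E$ is a linear map $\nabla:\mathcal E\to\mathcal E\otimes_{\mathcal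 A}B(\mathcal H)$ with $\nabla(\xi a)=(\nabla\xi)a+\xi\otimes[D,a]$ and $(\xi,\nabla\varepsilon)-(\varepsilon,\nabla\xi)^*=[D,(\xi,\varepsilon)]$; if $\sigma$ is even, $\nabla$ is required to be odd. Put $\sigma^{\mathcal E}=(\mathcal B,\mathcal H^{\mathcal E},D^{\mathcal E})$, where $\mathcal H^{\mathcal E}=\mathcal E\otimes_{\mathcal A}\mathcal H$ has inner product $\langle\xi_1\otimes h_1,\xi_2\otimes h_2\rangle=\langle h_1,(\xi_1,\xi_2)h_2\rangle$, and $D^{\mathcal E}(\xi\otimes h)=\xi\otimes Dh+(\nabla\xi)h$ with domain $\mathcal E\otimes_{\mathcal A}W^1(D)$, graded by $1\otimes\gamma$ in the even case. Unital spectral triples $\sigma_1=(\mathcal A_1,\mathcal H_1,D_1)$ and $\sigma_2=(\mathcal A_2,\mathcal H_2,D_2)$ are *Morita equivalent* if $\mathcal A_1,\mathcal A_2$ are Morita equivalent as algebras and there are an equivalence $\mathcal A_2$-$\mathcal A_1$-bimodule $\mathcal E$ and a $\sigma_1$-connection on $\mathcal E$ such that $\sigma_2$ is unitarily equivalent to $\sigma_1^{\mathcal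 E}$ (a unitary from $\overline{\mathcal H_1^{\mathcal E}}$ onto $\overline{\mathcal H_2}$ that carries $\mathcal H_1^{\mathcal E}$ onto $\mathcal H_2$ and intertwines representations, Dirac operators with their domains, and gradings, if any; either both triples are even or both are odd). **Theorem.** Morita equivalence of unital spectral triples is reflexive, symmetric and transitive. Moreover, symmetry is realised by the conjugate module: let $\mathcal E$ be an equivalence $\mathcal A_2$-$\mathcal A_1$-bimodule with a $\sigma_1$-connection $\nabla$ such that $\sigma_2$ is unitarily equivalent to $\sigma_1^{\mathcal E}$, and identify $\sigma_2$ with $\sigma_1^{\mathcal E}$. Then there is a $\sigma_2$-connection $\nabla^{\mathcal F}$ on $\mathcal F=\mathcal E^*$ given by $$(\nabla^{\mathcal F}f)(\xi\otimes h)=-f(\nabla\xi)\,h+[D_1,f\xi]\,h\qquad(f\in\mathcal F,\ \xi\in\mathcal E,\ h\in \overline{\mathcal H_1}),$$ where $\mathcal F\otimes_{\mathcal A_2}\overline{\mathcal H_1^{\mathcal E}}$ is identified with $\overline{\mathcal H_1}$ by $f\otimes\xi\otimes h\mapsto (f\xi)h$, and this identification is a unitary equivalence from $(\sigma_1^{\mathcal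 E})^{\mathcal F}$ to $\sigma_1$; in particular $(D_1^{\mathcal E})^{\mathcal F}=D_1$. -/

import Mathlib

open scoped TensorProduct InnerProductSpace
open MulOpposite

universe u v w

/-! ### Topological pre-C*-algebras -/

/-- A unital pre-C*-algebra (a unital complex `*`-algebra with a C*-norm, not necessarily complete)
which is also a locally convex topological `*`-algebra for a second topology `lcTop`, finer than
the norm topology.  (The instance topology is the norm topology.) -/
class LCPreCStarAlgebra (A : Type u) extends
    NormedRing A, StarRing A, CStarRing A, NormedAlgebra ℂ A, StarModule ℂ A where
  /-- the locally convex topology -/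
  lcTop : TopologicalSpace A
  lcTop_ring : @IsTopologicalRing A lcTop _
  lcTop_star : @ContinuousStar A lcTop _
  lcTop_smul : @ContinuousSMul ℂ A _ _ lcTop
  lcTop_locallyConvex : @LocallyConvexSpace ℝ A _ _ _ _ lcTop
  lcTop_le : lcTop ≤ (inferInstance : TopologicalSpace A)

/-- Positivity of an element of a pre-C*-algebra `A`, i.e. positivity in the completion of `A`:
the positive cone is the norm closure of the set of finite sums of elements `star b * b`. -/
def IsPreCStarPositive {A : Type u} [LCPreCStarAlgebra A] (a : A) : Prop :=
  a ∈ closure ((AddSubmonoid.closure (Set.range fun b : A => star b * b) : AddSubmonoid A) : Set A)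

/-! ### Bimodules and conjugate bimodules -/

/-- A unital `B`-`A`-bimodule for complex algebras `B` (acting on the left) and `A` (acting on the
right, i.e. as `Aᵐᵒᵖ`); the two induced complex vector space structures agree. -/
structure AlgBimodule (B A : Type u) [LCPreCStarAlgebra B] [LCPreCStarAlgebra A] where
  carrier : Type u
  [addCommGroup : AddCommGroup carrier]
  [moduleComplex : Module ℂ carrier]
  [moduleLeft : Module B carrier]
  [moduleRight : Module Aᵐᵒᵖ carrier]
  [towerLeft : IsScalarTower ℂ B carrier]
  [towerRight : IsScalarTower ℂ Aᵐᵒᵖ carrier]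
  [smulComm : SMulCommClass B Aᵐᵒᵖ carrier]

attribute [instance] AlgBimodule.addCommGroup AlgBimodule.moduleComplex AlgBimodule.moduleLeft AlgBimodule.moduleRight
  AlgBimodule.towerLeft AlgBimodule.towerRight AlgBimodule.smulComm

instance {B A : Type u} [LCPreCStarAlgebra B] [LCPreCStarAlgebra A] :
    CoeSort (AlgBimodule B A) (Type u) := ⟨AlgBimodule.carrier⟩

/-- The underlying additive group of the conjugate space: the element `toConj x` stands for
`f_x = (x, ·)`. -/
def ConjSpace (E : Type u) : Type u := E

namespace ConjSpace

instance (E : Type u) [AddCommGroup E] : AddCommGroup (ConjSpace E) :=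
  inferInstanceAs (AddCommGroup E)

/-- The bijection `x ↦ f_x`. -/
def toConj {E : Type u} [AddCommGroup E] : E ≃+ ConjSpace E := AddEquiv.refl E

variable {B A : Type u} [LCPreCStarAlgebra B] [LCPreCStarAlgebra A] (E : AlgBimodule B A)

/-- `c • f_x = f_{c̄ x}`. -/
instance instModuleComplex : Module ℂ (ConjSpace E) where
  smul c f := toConj (star c • toConj.symm f)
  one_smul f := by
    change toConj (star (1 : ℂ) • toConj.symm f) = f
    simp
  mul_smul c d f := by
    change toConj (star (c * d) • toConj.symm f) = toConj (star c • star d • toConj.symm f)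
    rw [smul_smul, star_mul, mul_comm]
  smul_zero c := by
    change toConj (star c • toConj.symm 0) = 0
    simp
  smul_add c f g := by
    change toConj (star c • toConj.symm (f + g)) = toConj (star c • _) + toConj (star c • _)
    simp
  add_smul c d f := by
    change toConj (star (c + d) • toConj.symm f) = toConj (star c • _) + toConj (star d • _)
    rw [star_add, add_smul, map_add]
  zero_smul f := by
    change toConj (star (0 : ℂ) • toConj.symm f) = 0
    simp

/-- `a • f_x = f_{x a*}`. -/
instance instModuleLeft : Module A (ConjSpace E) where
  smul a f := toConj (op (star a) • toConj.symm f)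
  one_smul f := by
    change toConj (op (star (1 : A)) • toConj.symm f) = f
    simp
  mul_smul a b f := by
    change toConj (op (star (a * b)) • toConj.symm f)
      = toConj (op (star a) • op (star b) • toConj.symm f)
    rw [smul_smul, star_mul, op_mul]
  smul_zero a := by
    change toConj (op (star a) • toConj.symm 0) = 0
    simp
  smul_add a f g := by
    change toConj (op (star a) • toConj.symm (f + g)) = toConj (op (star a) • _) + toConj _
    simp
  add_smul a b f := by
    change toConj (op (star (a + b)) • toConj.symm f) = toConj (op (star a) • _) + toConj _
    rw [star_add, op_add, add_smul, map_add]
  zero_smul f := by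
    change toConj (op (star (0 : A)) • toConj.symm f) = 0
    simp

/-- `f_x · b = f_{b* x}`. -/
instance instModuleRight : Module Bᵐᵒᵖ (ConjSpace E) where
  smul b f := toConj (star (unop b) • toConj.symm f)
  one_smul f := by
    change toConj (star (unop (1 : Bᵐᵒᵖ)) • toConj.symm f) = f
    simp
  mul_smul a b f := by
    change toConj (star (unop (a * b)) • toConj.symm f)
      = toConj (star (unop a) • star (unop b) • toConj.symm f)
    rw [smul_smul, unop_mul, star_mul]
  smul_zero a := by
    change toConj (star (unop a) • toConj.symm 0) = 0
    simp
  smul_add a f g := by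
    change toConj (star (unop a) • toConj.symm (f + g)) = toConj (star (unop a) • _) + toConj _
    simp
  add_smul a b f := by
    change toConj (star (unop (a + b)) • toConj.symm f) = toConj (star (unop a) • _) + toConj _
    rw [unop_add, star_add, add_smul, map_add]
  zero_smul f := by
    change toConj (star (unop (0 : Bᵐᵒᵖ)) • toConj.symm f) = 0
    simp

end ConjSpace

open ConjSpace (toConj)

/-- The conjugate `A`-`B`-bimodule `E* = {f_x : x ∈ E}` of a `B`-`A`-bimodule `E`, with
`a • f_x = f_{x a*}` and `f_x · b = f_{b* x}`. -/
def AlgBimodule.conj {B A : Type u} [LCPreCStarAlgebra B] [LCPreCStarAlgebra A] (E : AlgBimodule B A) :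
    AlgBimodule A B where
  carrier := ConjSpace E
  towerLeft := ⟨fun c a f => by
    change toConj (op (star (c • a)) • toConj.symm f)
      = toConj (star c • op (star a) • toConj.symm f)
    rw [star_smul, op_smul, smul_assoc]⟩
  towerRight := ⟨fun c b f => by
    change toConj (star (unop (c • b)) • toConj.symm f)
      = toConj (star c • star (unop b) • toConj.symm f)
    rw [unop_smul, star_smul, smul_assoc]⟩
  smulComm := ⟨fun a b f => by
    change toConj (op (star a) • star (unop b) • toConj.symm f)
      = toConj (star (unop b) • op (star a) • toConj.symm f)
    rw [(smul_comm (star (unop b)) (op (star a)) (toConj.symm f : E) :)]⟩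

/-- The bijection `x ↦ f_x` from `E` onto `E*`. -/
def AlgBimodule.toConj {B A : Type u} [LCPreCStarAlgebra B] [LCPreCStarAlgebra A] (E : AlgBimodule B A) :
    E ≃+ E.conj := ConjSpace.toConj

/-! ### Finite Kasparov modules and equivalence bimodules -/

/-- A finite Kasparov `B`-`A`-module structure on the bimodule `E`. -/
structure FiniteKasparov {B A : Type u} [LCPreCStarAlgebra B] [LCPreCStarAlgebra A]
    (E : AlgBimodule B A) where
  /-- the `A`-valued inner product, `A`-linear in the second variable -/
  inner : E → (E →ₗ[Aᵐᵒᵖ] A)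
  inner_star : ∀ x y, inner x y = star (inner y x)
  inner_self_pos : ∀ x, IsPreCStarPositive (inner x x)
  inner_self_eq_zero : ∀ x, inner x x = 0 → x = 0
  /-- the topology of `E` -/
  top : TopologicalSpace E
  /-- `E` is unitarily isomorphic to `p Aⁿ` for a projection `p ∈ Mₙ(A)`, and its topology is
  induced from the locally convex topology of `A` -/
  finite_projective : ∃ (n : ℕ) (p : Matrix (Fin n) (Fin n) A) (φ : E →ₗ[Aᵐᵒᵖ] (Fin n → A)),
    IsStarProjection p ∧ Function.Injective φ ∧ Set.range φ = {c | p.mulVec c = c} ∧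
    (∀ x y, inner x y = ∑ i, star (φ x i) * φ y i) ∧
    @Topology.IsInducing E (Fin n → A) top
      (@Pi.topologicalSpace (Fin n) (fun _ => A) fun _ => LCPreCStarAlgebra.lcTop) φ
  /-- `B → B_A(E)` is `*`-preserving -/
  inner_smul : ∀ (b : B) (x y : E), inner (b • x) y = inner x (star b • y)
  /-- `B → B_A(E)` is continuous for the norm `‖x‖ = ‖(x, x)‖^{1/2}` of `E` -/
  norm_smul : ∃ C : ℝ, ∀ (b : B) (x : E),
    ‖inner (b • x) (b • x)‖ ≤ C * ‖b‖ ^ 2 * ‖inner x x‖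
  /-- `B × E → E` is jointly continuous for the locally convex topologies -/
  jointly_continuous : @Continuous (B × E) E
    (@instTopologicalSpaceProd B E LCPreCStarAlgebra.lcTop top) top (fun q => q.1 • q.2)

/-- An equivalence bimodule structure on a `B`-`A`-bimodule `E`: `E` is a finite Kasparov
`B`-`A`-module and `E*` is a finite Kasparov `A`-`B`-module (equivalently, `E` also carries a left
`B`-valued inner product `⟨x, y⟩ := (f_x, f_y)` with the corresponding properties),
`⟨x, y⟩ z = x (y, z)`, and both inner products are full. -/
structure EquivalenceBimodule {B A : Type u} [LCPreCStarAlgebra B] [LCPreCStarAlgebra A]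
    (E : AlgBimodule B A) where
  right : FiniteKasparov E
  left : FiniteKasparov E.conj
  assoc : ∀ x y z : E, (left.inner (E.toConj x) (E.toConj y)) • z = op (right.inner y z) • x
  full_right : Submodule.span ℂ {a : A | ∃ x y : E, a = right.inner x y} = ⊤
  full_left : Submodule.span ℂ {b : B | ∃ x y : E.conj, b = left.inner x y} = ⊤

/-! ### Balanced tensor products -/

section BalTensor

variable {B A : Type u} [LCPreCStarAlgebra B] [LCPreCStarAlgebra A] (E : AlgBimodule B A)
  {M : Type v} [AddCommGroup M] [Module ℂ M] (ρ : A →ₐ[ℂ] Module.End ℂ M)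

/-- The span of the elements `ξ a ⊗ m - ξ ⊗ a m`. -/
def balancedRelations : Submodule ℂ (E ⊗[ℂ] M) :=
  Submodule.span ℂ {t | ∃ (ξ : E) (a : A) (m : M), t = (op a • ξ) ⊗ₜ[ℂ] m - ξ ⊗ₜ[ℂ] (ρ a m)}

/-- The tensor product `E ⊗_A M`, where `A` acts on `M` by `ρ`. -/
abbrev BalTensor : Type (max u v) := (E ⊗[ℂ] M) ⧸ balancedRelations E ρ

namespace BalTensor

variable {E}

/-- The elementary tensor `ξ ⊗_A m`. -/
def tmul (ξ : E) (m : M) : BalTensor E ρ := (balancedRelations E ρ).mkQ (ξ ⊗ₜ[ℂ] m)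

/-- The map on `E ⊗_A M` induced by a balanced bilinear map. -/
noncomputable def lift {N : Type w} [AddCommGroup N] [Module ℂ N] (f : E →ₗ[ℂ] M →ₗ[ℂ] N)
    (hf : ∀ ξ a m, f (op a • ξ) m = f ξ (ρ a m)) : BalTensor E ρ →ₗ[ℂ] N :=
  (balancedRelations E ρ).liftQ (TensorProduct.lift f) (by
    rw [balancedRelations, Submodule.span_le]
    rintro _ ⟨ξ, a, m, rfl⟩
    simp [hf])

theorem lift_tmul {N : Type w} [AddCommGroup N] [Module ℂ N] (f : E →ₗ[ℂ] M →ₗ[ℂ] N)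
    (hf : ∀ ξ a m, f (op a • ξ) m = f ξ (ρ a m)) (ξ : E) (m : M) :
    lift ρ f hf (tmul ρ ξ m) = f ξ m := by
  simp [lift, tmul]

theorem smul_tmul (ξ : E) (a : A) (m : M) : tmul ρ (op a • ξ) m = tmul ρ ξ (ρ a m) := by
  rw [tmul, tmul, ← sub_eq_zero, ← map_sub]
  exact (Submodule.Quotient.mk_eq_zero _).2 (Submodule.subset_span ⟨ξ, a, m, rfl⟩)

/-- The bilinear map `(ξ, m) ↦ ξ ⊗_A m`. -/
noncomputable def mk : E →ₗ[ℂ] M →ₗ[ℂ] BalTensor E ρ :=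
  (TensorProduct.mk ℂ E M).compr₂ (balancedRelations E ρ).mkQ

/-- `1 ⊗_A T` for an `A`-linear map `T : M → N`. -/
noncomputable def map {N : Type w} [AddCommGroup N] [Module ℂ N] {ρ : A →ₐ[ℂ] Module.End ℂ M}
    {ρ' : A →ₐ[ℂ] Module.End ℂ N} (T : M →ₗ[ℂ] N) (hT : ∀ a m, T (ρ a m) = ρ' a (T m)) :
    BalTensor E ρ →ₗ[ℂ] BalTensor E ρ' :=
  lift ρ ((mk ρ').compl₂ T) fun ξ a m => by
    change tmul ρ' (op a • ξ) (T m) = tmul ρ' ξ (T (ρ a m))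
    rw [smul_tmul, hT]

theorem map_tmul {N : Type w} [AddCommGroup N] [Module ℂ N] {ρ : A →ₐ[ℂ] Module.End ℂ M}
    {ρ' : A →ₐ[ℂ] Module.End ℂ N} (T : M →ₗ[ℂ] N) (hT : ∀ a m, T (ρ a m) = ρ' a (T m))
    (ξ : E) (m : M) : map T hT (tmul ρ ξ m) = tmul ρ' ξ (T m) := by
  rw [map, lift_tmul]
  rfl

end BalTensor

end BalTensor

/-! ### Unbounded operators -/

section Operators

variable {H : Type v} [NormedAddCommGroup H] [InnerProductSpace ℂ H]

/-- The domain of `Dⁿ`. -/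
def powDomain (D : H →ₗ.[ℂ] H) : ℕ → Submodule ℂ H
  | 0 => ⊤
  | n + 1 => ((powDomain D n).comap D.toFun).map D.domain.subtype

/-- `W^∞(D)`, the intersection of the domains of all powers of `D`. -/
def smoothDomain (D : H →ₗ.[ℂ] H) : Submodule ℂ H := ⨅ n, powDomain D n

theorem smoothDomain_le (D : H →ₗ.[ℂ] H) : smoothDomain D ≤ D.domain := fun x hx => by
  have h : x ∈ powDomain D 1 := (Submodule.mem_iInf _).1 hx 1
  obtain ⟨y, -, rfl⟩ := h
  exact y.2

theorem apply_mem_smoothDomain (D : H →ₗ.[ℂ] H) (x : smoothDomain D) :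
    D ⟨x, smoothDomain_le D x.2⟩ ∈ smoothDomain D := by
  refine (Submodule.mem_iInf _).2 fun n => ?_
  have h : (x : H) ∈ powDomain D (n + 1) := (Submodule.mem_iInf _).1 x.2 (n + 1)
  obtain ⟨y, hy, hyx⟩ := h
  have hy' : y = ⟨x, smoothDomain_le D x.2⟩ := Subtype.ext hyx
  rw [← hy']
  exact hy

/-- The restriction `D : W^∞(D) → W^∞(D)`. -/
def smoothOp (D : H →ₗ.[ℂ] H) : smoothDomain D →ₗ[ℂ] smoothDomain D :=
  (D.toFun ∘ₗ Submodule.inclusion (smoothDomain_le D)).codRestrict _ (apply_mem_smoothDomain D)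

/-- The Fréchet topology of `W^∞(D)`, given by the seminorms `h ↦ ‖Dⁿ h‖`, `n = 0, 1, 2, …`. -/
@[reducible] def smoothTopology (D : H →ₗ.[ℂ] H) : TopologicalSpace (smoothDomain D) :=
  TopologicalSpace.induced (fun h (n : ℕ) => (((smoothOp D) ^ n) h : H)) inferInstance

/-- `D` has compact resolvent: `(D - z)⁻¹` exists and is compact for some complex number `z`. -/
def HasCompactResolvent (D : H →ₗ.[ℂ] H) : Prop :=
  ∃ (z : ℂ) (R : H →L[ℂ] H), IsCompactOperator R ∧
    (∀ x, ∃ hx : R x ∈ D.domain, D ⟨R x, hx⟩ - z • R x = x) ∧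
    ∀ x : D.domain, R (D x - z • (x : H)) = x

/-- The `*`-algebra `B(V)` of a (dense) subspace `V` of a Hilbert space: the bounded operators `T`
with `T V ⊆ V` and `T* V ⊆ V`. -/
def boundedEnd [CompleteSpace H] (V : Submodule ℂ H) : StarSubalgebra ℂ (H →L[ℂ] H) where
  carrier := {T | ∀ x ∈ V, T x ∈ V ∧ (star T) x ∈ V}
  mul_mem' {S T} hS hT x hx :=
    ⟨(hS _ (hT x hx).1).1, by rw [star_mul]; exact (hT _ (hS x hx).2).2⟩
  add_mem' {S T} hS hT x hx :=
    ⟨V.add_mem (hS x hx).1 (hT x hx).1, by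
      rw [star_add]; exact V.add_mem (hS x hx).2 (hT x hx).2⟩
  algebraMap_mem' c x hx :=
    ⟨by simpa [Algebra.algebraMap_eq_smul_one] using V.smul_mem c hx, by
      simpa [Algebra.algebraMap_eq_smul_one] using V.smul_mem (star c) hx⟩
  star_mem' {T} hT x hx := ⟨(hT x hx).2, by rw [star_star]; exact (hT x hx).1⟩

end Operators

/-! ### Spectral triples -/

/-- A unital spectral triple `(A, 𝓗, D)`.  Here `H` is the Hilbert space completion of the
pre-Hilbert space `𝓗 = W^∞(D)`.  The triple is even if it comes with a grading operator and odd if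
it does not. -/
structure UnitalSpectralTriple where
  A : Type u
  [algebra : LCPreCStarAlgebra A]
  H : Type v
  [normedAddCommGroup : NormedAddCommGroup H]
  [innerProductSpace : InnerProductSpace ℂ H]
  [completeSpace : CompleteSpace H]
  /-- the unital `*`-representation -/
  rep : A →⋆ₐ[ℂ] (H →L[ℂ] H)
  rep_continuous : Continuous rep
  /-- the Dirac operator -/
  D : H →ₗ.[ℂ] H
  isSelfAdjoint : IsSelfAdjoint D
  compactResolvent : HasCompactResolvent D
  dense_smooth : Dense (smoothDomain D : Set H)
  rep_smooth : ∀ a, ∀ h ∈ smoothDomain D, rep a h ∈ smoothDomain D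
  /-- the commutator `[D, a] : 𝓗 → 𝓗` is norm-bounded, i.e. extends to a bounded operator -/
  bounded_commutator : ∀ a, ∃ T : H →L[ℂ] H, ∀ h : smoothDomain D,
    T h = smoothOp D ⟨rep a h, rep_smooth a h h.2⟩ - rep a (smoothOp D h)
  /-- `A × 𝓗 → 𝓗` is jointly continuous -/
  rep_jointly_continuous : @Continuous (A × smoothDomain D) (smoothDomain D)
    (@instTopologicalSpaceProd A (smoothDomain D) LCPreCStarAlgebra.lcTop (smoothTopology D))
    (smoothTopology D) (fun q => ⟨rep q.1 q.2, rep_smooth q.1 q.2 q.2.2⟩)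
  /-- the grading operator, if the triple is even -/
  grading : Option (H →L[ℂ] H)
  grading_star : ∀ γ ∈ grading, IsSelfAdjoint γ
  grading_sq : ∀ γ ∈ grading, γ * γ = 1
  grading_rep : ∀ γ ∈ grading, ∀ a, γ * rep a = rep a * γ
  grading_D : ∀ γ ∈ grading, ∀ x : D.domain, ∃ hx : γ x ∈ D.domain, D ⟨γ x, hx⟩ = - γ (D x)

namespace UnitalSpectralTriple

attribute [instance] algebra normedAddCommGroup innerProductSpace completeSpace

variable (σ : UnitalSpectralTriple.{u, v})

/-- `B(𝓗)`. -/
abbrev BH : StarSubalgebra ℂ (σ.H →L[ℂ] σ.H) := boundedEnd (smoothDomain σ.D)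

/-- The representation `A → B(𝓗)`. -/
noncomputable def repBH : σ.A →⋆ₐ[ℂ] σ.BH :=
  σ.rep.codRestrict σ.BH fun a h hh =>
    ⟨σ.rep_smooth a h hh, by rw [← map_star]; exact σ.rep_smooth (star a) h hh⟩

/-- The action of `A` on `H`. -/
noncomputable def actH : σ.A →ₐ[ℂ] Module.End ℂ σ.H :=
  { ContinuousLinearMap.toLinearMapRingHom.comp (σ.rep : σ.A →+* (σ.H →L[ℂ] σ.H)) with
    commutes' := fun c => LinearMap.ext fun h => by
      change σ.rep (algebraMap ℂ σ.A c) h = c • h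
      rw [AlgHomClass.commutes]
      simp [Algebra.algebraMap_eq_smul_one] }

/-- The action of `A` on `B(𝓗)` by left multiplication. -/
noncomputable def actBH : σ.A →ₐ[ℂ] Module.End ℂ σ.BH :=
  (Algebra.lmul ℂ σ.BH).comp σ.repBH.toAlgHom

theorem D_symm (x y : smoothDomain σ.D) :
    ⟪(smoothOp σ.D x : σ.H), (y : σ.H)⟫_ℂ = ⟪(x : σ.H), (smoothOp σ.D y : σ.H)⟫_ℂ := by
  have hd := σ.isSelfAdjoint.dense_domain
  have h := LinearPMap.adjoint_isFormalAdjoint (T := σ.D) hd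
  rw [LinearPMap.isSelfAdjoint_def.1 σ.isSelfAdjoint] at h
  exact h ⟨x, smoothDomain_le _ x.2⟩ ⟨y, smoothDomain_le _ y.2⟩

/-- The bounded operator on `H` that extends `[D, a] : 𝓗 → 𝓗` (unique, as `𝓗` is dense). -/
noncomputable def commutatorCLM (a : σ.A) : σ.H →L[ℂ] σ.H := (σ.bounded_commutator a).choose

theorem commutatorCLM_apply (a : σ.A) (h : smoothDomain σ.D) :
    σ.commutatorCLM a h
      = smoothOp σ.D ⟨σ.rep a h, σ.rep_smooth a h h.2⟩ - σ.rep a (smoothOp σ.D h) :=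
  (σ.bounded_commutator a).choose_spec h

theorem star_commutatorCLM (a : σ.A) :
    star (σ.commutatorCLM a) = - σ.commutatorCLM (star a) := by
  have key : ∀ x y : smoothDomain σ.D, ⟪star (σ.commutatorCLM a) (x : σ.H), (y : σ.H)⟫_ℂ
      = ⟪(- σ.commutatorCLM (star a)) (x : σ.H), (y : σ.H)⟫_ℂ := fun x y => by
    have hs : ∀ (b : σ.A) (u v : σ.H), ⟪σ.rep (star b) u, v⟫_ℂ = ⟪u, σ.rep b v⟫_ℂ :=
      fun b u v => by
        rw [map_star, ContinuousLinearMap.star_eq_adjoint,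
          ContinuousLinearMap.adjoint_inner_left]
    have h1 := σ.D_symm x ⟨σ.rep a y, σ.rep_smooth a y y.2⟩
    have h2 := σ.D_symm ⟨σ.rep (star a) x, σ.rep_smooth _ x x.2⟩ y
    simp only at h1 h2
    rw [ContinuousLinearMap.star_eq_adjoint, ContinuousLinearMap.adjoint_inner_left,
      neg_apply, inner_neg_left, σ.commutatorCLM_apply,
      σ.commutatorCLM_apply, inner_sub_right, inner_sub_left, h2, hs, hs, ← h1]
    ring
  have hx : ∀ x : smoothDomain σ.D,
      star (σ.commutatorCLM a) (x : σ.H) = (- σ.commutatorCLM (star a)) (x : σ.H) :=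
    fun x => σ.dense_smooth.eq_of_inner_left ℂ fun y hy => key x ⟨y, hy⟩
  exact ContinuousLinearMap.ext fun x => congrFun
    (Continuous.ext_on σ.dense_smooth (star (σ.commutatorCLM a)).continuous
      (- σ.commutatorCLM (star a)).continuous fun y hy => hx ⟨y, hy⟩) x

theorem commutatorCLM_smooth (a : σ.A) (h : σ.H) (hh : h ∈ smoothDomain σ.D) :
    σ.commutatorCLM a h ∈ smoothDomain σ.D := by
  rw [σ.commutatorCLM_apply a ⟨h, hh⟩]
  exact (smoothDomain σ.D).sub_mem (Subtype.coe_prop _) (σ.rep_smooth _ _ (Subtype.coe_prop _))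

/-- The commutator `[D, a]` as an element of `B(𝓗)`. -/
noncomputable def commutator (a : σ.A) : σ.BH :=
  ⟨σ.commutatorCLM a, fun h hh => ⟨σ.commutatorCLM_smooth a h hh, by
    rw [σ.star_commutatorCLM]
    exact (smoothDomain σ.D).neg_mem (σ.commutatorCLM_smooth (star a) h hh)⟩⟩

/-! ### Connections -/

variable {B : Type u} [LCPreCStarAlgebra B] {E : AlgBimodule B σ.A}

/-- The right multiplication `(ξ ⊗ S) T = ξ ⊗ S T` on `E ⊗_A B(𝓗)`. -/
noncomputable def rightMul (T : σ.BH) : BalTensor E σ.actBH →ₗ[ℂ] BalTensor E σ.actBH :=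
  BalTensor.map (LinearMap.mulRight ℂ T) fun a S => mul_assoc (σ.repBH a) S T

/-- The evaluation `(ξ ⊗ T) h = ξ ⊗ T h`, from `E ⊗_A B(𝓗)` to `E ⊗_A H`. -/
noncomputable def eval (h : σ.H) : BalTensor E σ.actBH →ₗ[ℂ] BalTensor E σ.actH :=
  BalTensor.map
    ({ toFun := fun T => (T : σ.H →L[ℂ] σ.H) h
       map_add' := fun _ _ => rfl
       map_smul' := fun _ _ => rfl } : σ.BH →ₗ[ℂ] σ.H)
    fun _ _ => rfl

/-- The operator `1 ⊗ γ` on `E ⊗_A H`. -/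
noncomputable def gradingTensor (γ : σ.H →L[ℂ] σ.H) (hγ : γ ∈ σ.grading) :
    BalTensor E σ.actH →ₗ[ℂ] BalTensor E σ.actH :=
  BalTensor.map (γ : σ.H →ₗ[ℂ] σ.H) fun a h => congrArg (fun T => T h) (σ.grading_rep γ hγ a)

/-- The pairing `(ξ, ε ⊗ T) = (ξ, ε) T`, from `E ⊗_A B(𝓗)` to `B(𝓗)`. -/
noncomputable def pairing (K : FiniteKasparov E) (ξ : E) : BalTensor E σ.actBH →ₗ[ℂ] σ.BH :=
  BalTensor.lift σ.actBH
    ((Algebra.lmul ℂ σ.BH).toLinearMap ∘ₗ σ.repBH.toAlgHom.toLinearMap ∘ₗ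
      (K.inner ξ).restrictScalars ℂ)
    fun ε a T => by
      change σ.repBH (K.inner ξ (op a • ε)) * T = σ.repBH (K.inner ξ ε) * (σ.repBH a * T)
      rw [map_smul, op_smul_eq_mul, map_mul, mul_assoc]

end UnitalSpectralTriple

open UnitalSpectralTriple

/-- A `σ`-connection on a finite Kasparov `B`-`A`-module `E`, for a spectral triple
`σ = (A, 𝓗, D)`.  For even `σ` the connection is required to be odd. -/
structure SigmaConnection (σ : UnitalSpectralTriple.{u, v}) {B : Type u} [LCPreCStarAlgebra B]
    {E : AlgBimodule B σ.A} (K : FiniteKasparov E) where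
  nabla : E →ₗ[ℂ] BalTensor E σ.actBH
  /-- `∇(ξ a) = (∇ξ) a + ξ ⊗ [D, a]` -/
  leibniz : ∀ (ξ : E) (a : σ.A), nabla (op a • ξ)
    = σ.rightMul (σ.repBH a) (nabla ξ) + BalTensor.tmul σ.actBH ξ (σ.commutator a)
  /-- `(ξ, ∇ε) - (∇ξ, ε) = [D, (ξ, ε)]`, where `(∇ξ, ε)` stands for `(ε, ∇ξ)*` -/
  hermitian : ∀ ξ ε : E, σ.pairing K ξ (nabla ε) - star (σ.pairing K ε (nabla ξ))
    = σ.commutator (K.inner ξ ε)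
  odd : ∀ (γ : σ.H →L[ℂ] σ.H) (hγ : γ ∈ σ.grading) (ξ : E) (h : σ.H),
    σ.eval (γ h) (nabla ξ) = - σ.gradingTensor γ hγ (σ.eval h (nabla ξ))

/-! ### The triple `σ^E = (B, 𝓗^E, D^E)` and Morita equivalence -/

section Twist

variable {σ : UnitalSpectralTriple.{u, v}} {B : Type u} [LCPreCStarAlgebra B]
  (E : AlgBimodule B σ.A)

/-- `𝓗^E = E ⊗_A 𝓗` inside `E ⊗_A H`.  (As `E` is a summand of a free module, `E ⊗_A H` is a Hilbert
space for the inner product `⟨ξ ⊗ h, ε ⊗ k⟩ = ⟨h, (ξ, ε) k⟩`; it is the completion of `𝓗^E`.) -/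
noncomputable def twistSmooth : Submodule ℂ (BalTensor E σ.actH) :=
  Submodule.span ℂ {t | ∃ (ξ : E) (h : smoothDomain σ.D), t = BalTensor.tmul σ.actH ξ (h : σ.H)}

/-- The graph of `D^E`, with domain `E ⊗_A W¹(D)` and `D^E (ξ ⊗ h) = ξ ⊗ D h + (∇ξ) h`. -/
noncomputable def twistGraph {K : FiniteKasparov E} (C : SigmaConnection σ K) :
    Submodule ℂ (BalTensor E σ.actH × BalTensor E σ.actH) :=
  Submodule.span ℂ {t | ∃ (ξ : E) (h : σ.D.domain),
    t = (BalTensor.tmul σ.actH ξ (h : σ.H),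
      BalTensor.tmul σ.actH ξ (σ.D h) + σ.eval (h : σ.H) (C.nabla ξ))}

end Twist

/-- `U : E ⊗_A H → H_τ` is a unitary equivalence from `σ^E = (B, 𝓗^E, D^E)` to the spectral triple
`τ = (B, 𝓗_τ, D_τ)`: a unitary operator that maps `𝓗^E` onto `𝓗_τ`, intertwines the two
representations of `B` and the two Dirac operators (with their domains), and, in the even case,
the gradings `1 ⊗ γ` and `γ_τ`. -/
structure IsUnitaryEquivTwist (σ τ : UnitalSpectralTriple.{u, v}) {E : AlgBimodule τ.A σ.A}
    {K : FiniteKasparov E} (C : SigmaConnection σ K) (U : BalTensor E σ.actH ≃ₗ[ℂ] τ.H) :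
    Prop where
  inner_map : ∀ (ξ ε : E) (h k : σ.H),
    ⟪U (BalTensor.tmul σ.actH ξ h), U (BalTensor.tmul σ.actH ε k)⟫_ℂ
      = ⟪h, σ.rep (K.inner ξ ε) k⟫_ℂ
  map_smooth : (twistSmooth E).map (U : BalTensor E σ.actH →ₗ[ℂ] τ.H) = smoothDomain τ.D
  map_rep : ∀ (b : τ.A) (ξ : E) (h : σ.H),
    U (BalTensor.tmul σ.actH (b • ξ) h) = τ.rep b (U (BalTensor.tmul σ.actH ξ h))
  map_dirac : (twistGraph E C).map
    ((U : BalTensor E σ.actH →ₗ[ℂ] τ.H).prodMap (U : BalTensor E σ.actH →ₗ[ℂ] τ.H)) = τ.D.graph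
  even_iff : σ.grading.isSome ↔ τ.grading.isSome
  map_grading : ∀ γ ∈ σ.grading, ∀ γ' ∈ τ.grading, ∀ (ξ : E) (h : σ.H),
    U (BalTensor.tmul σ.actH ξ (γ h)) = γ' (U (BalTensor.tmul σ.actH ξ h))

/-- Morita equivalence of unital spectral triples. -/
def SpectralMoritaEquivalent (σ τ : UnitalSpectralTriple.{u, v}) : Prop :=
  IsMoritaEquivalent ℂ σ.A τ.A ∧
  ∃ (E : AlgBimodule τ.A σ.A) (K : EquivalenceBimodule E) (C : SigmaConnection σ K.right)
    (U : BalTensor E σ.actH ≃ₗ[ℂ] τ.H), IsUnitaryEquivTwist σ τ C U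

/-!
A Morita equivalence of spectral triples is the same thing as a representation of an equivalence
bimodule by operators between the two Hilbert spaces that have bounded commutators with the Dirac
operators. Given a unitary equivalence `U : E ⊗_A H → H_τ` from `σ^E` to `τ`, the operators
`L ξ : h ↦ U (ξ ⊗ h)` are bounded, they satisfy `(L ξ)* L η = (ξ, η)` and `L ξ (L η)* = ⟨ξ, η⟩`, and the
description of `D_τ` as `D^E` says that `∇ ξ`, evaluated on `H`, is the commutator
`D_τ L ξ - L ξ D_σ`. Conversely suppose that operators `L ξ` with these relations preserve the smooth domains
together with their adjoints and have bounded commutators with the Dirac operators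
(`IsDiracRepresentation`). As the left inner product is full, there are `u i`, `v i` in `E` with
`∑ i, ⟨u i, v i⟩ = 1`. They form a dual basis of `E`, and `∑ i, L (u i) (L (v i))* = 1`. Therefore
`ξ ⊗ h ↦ L ξ h` is bijective, and `ξ ⊗ T ↦ L ξ T` is injective on `E ⊗_A B(𝓗)` with all smooth
operators in its image. So the commutators define a map `∇` to `E ⊗_A B(𝓗)`, for which the axioms
of a connection are the Leibniz rule applied to the products `L ξ a` and `(L ξ)* L ε`; oddness
holds because `L ξ` intertwines the gradings, which anticommute with the Dirac operators. The two
directions are `IsUnitaryEquivTwist.isDiracRepresentation` and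
`IsDiracRepresentation.isUnitaryEquivTwist`.

In this form the three properties of an equivalence relation are plain: `L` is the representation
of `A` itself on the identity bimodule, `f_x ↦ (L x)*` on the conjugate bimodule, and
`x₂ ⊗ x₁ ↦ L₂ x₂ L₁ x₁` on a tensor product. For the conjugate the commutator is the negative of the adjoint
of the commutator of `L x`, which is the formula for `∇^𝓕`.

Two analytic facts enter. The smooth domain is a core for the Dirac operator
(`graph_subset_closure_smooth`), so that the commutator identities extend to the whole of its
domain. In a pre-C*-algebra, `‖a i‖ ^ 2 ≤ ‖∑ j, a j* a j‖` (`sq_norm_le_norm_sum_star_mul_self`),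
by passage to the completion; this yields definiteness of the inner product and boundedness of the
left action for any module with a finite frame and bounded coefficients `b ↦ (x, b y)`
(`FiniteKasparov.ofFrame`), in particular for tensor products of bimodules.
-/

/-! ### Sums of squares in a pre-C*-algebra -/

section Completion

open UniformSpace

variable {A : Type u} [NormedRing A] [StarRing A] [CStarRing A] [NormedAlgebra ℂ A]
  [StarModule ℂ A]

/-- The completion of a unital pre-C*-algebra is a C*-algebra, with the involution extended by
continuity. -/
@[reducible] noncomputable def completionCStarAlgebra : CStarAlgebra (Completion A) :=
  have hs : UniformContinuous (star : A → A) := star_isometry.uniformContinuous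
  have hc : Continuous (Completion.map (star : A → A)) := Completion.continuous_map
  have hcoe : ∀ a : A, Completion.map star (a : Completion A) = ((star a : A) : Completion A) :=
    Completion.map_coe hs
  letI : Star (Completion A) := ⟨Completion.map star⟩
  { star_involutive := fun x => by
      change Completion.map star (Completion.map star x) = x
      refine Completion.induction_on x (isClosed_eq (hc.comp hc) continuous_id) fun a => ?_
      rw [hcoe, hcoe, star_star]
    star_mul := fun x y => by
      change Completion.map star (x * y) = Completion.map star y * Completion.map star x
      refine Completion.induction_on₂ x y (isClosed_eq (hc.comp continuous_mul)
        ((hc.comp continuous_snd).mul (hc.comp continuous_fst))) fun a b => ?_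
      rw [← Completion.coe_mul, hcoe, hcoe, hcoe, star_mul, Completion.coe_mul]
    star_add := fun x y => by
      change Completion.map star (x + y) = Completion.map star x + Completion.map star y
      refine Completion.induction_on₂ x y (isClosed_eq (hc.comp continuous_add)
        ((hc.comp continuous_fst).add (hc.comp continuous_snd))) fun a b => ?_
      rw [← Completion.coe_add, hcoe, hcoe, hcoe, star_add, Completion.coe_add]
    norm_mul_self_le := fun x => by
      change ‖x‖ * ‖x‖ ≤ ‖Completion.map star x * x‖
      refine Completion.induction_on x (isClosed_le (continuous_norm.mul continuous_norm)
        (continuous_norm.comp (hc.mul continuous_id))) fun a => ?_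
      rw [hcoe, ← Completion.coe_mul, Completion.norm_coe, Completion.norm_coe,
        CStarRing.norm_star_mul_self]
    norm_smul_le := norm_smul_le
    star_smul := fun c x => by
      change Completion.map star (c • x) = star c • Completion.map star x
      refine Completion.induction_on x
        (isClosed_eq (hc.comp (continuous_const_smul c)) ((continuous_const_smul _).comp hc))
        fun a => ?_
      rw [← Completion.coe_smul, hcoe, hcoe, star_smul, Completion.coe_smul] }

/-- Positivity of sums of squares is used in the completion, where `0 ≤ a i* a i ≤ ∑ j, a j* a j`
implies the inequality of norms. -/
theorem sq_norm_le_norm_sum_star_mul_self {ι : Type*} [Fintype ι] (a : ι → A) (i : ι) :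
    ‖a i‖ ^ 2 ≤ ‖∑ j, star (a j) * a j‖ := by
  let _ := completionCStarAlgebra (A := A)
  let _ := CStarAlgebra.spectralOrder (Completion A)
  have := CStarAlgebra.spectralOrderedRing (Completion A)
  have hs : ∀ b : A, ((star b : A) : Completion A) = star (b : Completion A) := fun b =>
    (Completion.map_coe star_isometry.uniformContinuous b).symm
  have h : star (a i : Completion A) * a i ≤ ∑ j, star (a j : Completion A) * a j :=
    Finset.single_le_sum (f := fun j => star (a j : Completion A) * a j)
      (fun j _ => star_mul_self_nonneg (a j : Completion A)) (Finset.mem_univ i)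
  have h' := CStarAlgebra.norm_le_norm_of_nonneg_of_le (star_mul_self_nonneg _) h
  have hsum : ((∑ j, star (a j) * a j : A) : Completion A)
      = ∑ j, star (a j : Completion A) * a j := by
    have := map_sum (Completion.coeRingHom : A →+* Completion A) (fun j => star (a j) * a j)
      Finset.univ
    refine this.trans (Finset.sum_congr rfl fun j _ => ?_)
    change ((star (a j) * a j : A) : Completion A) = _
    rw [Completion.coe_mul, hs]
  rw [← hsum, Completion.norm_coe, ← hs, ← Completion.coe_mul, Completion.norm_coe,
    CStarRing.norm_star_mul_self] at h'
  rw [pow_two]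
  exact h'

end Completion

/-! ### Operators with a bounded commutator -/

section SmoothDomain

variable {H : Type v} [NormedAddCommGroup H] [InnerProductSpace ℂ H]

theorem mem_powDomain_succ {D : H →ₗ.[ℂ] H} {n : ℕ} {x : H} :
    x ∈ powDomain D (n + 1) ↔ ∃ y ∈ powDomain D n, (x, y) ∈ D.graph := by
  constructor
  · rintro ⟨y, hy, rfl⟩
    exact ⟨D y, hy, D.mem_graph y⟩
  · rintro ⟨y, hy, hxy⟩
    obtain ⟨z, hz, hzy⟩ := (LinearPMap.mem_graph_iff D).1 hxy
    exact ⟨z, by change D z ∈ powDomain D n; rwa [hzy], hz⟩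

theorem mem_smoothDomain_of_graph {D : H →ₗ.[ℂ] H} {x y : H} (hxy : (x, y) ∈ D.graph)
    (hx : x ∈ smoothDomain D) : y ∈ smoothDomain D := by
  obtain ⟨z, rfl, rfl⟩ := (LinearPMap.mem_graph_iff D).1 hxy
  exact apply_mem_smoothDomain D ⟨z, hx⟩

theorem graph_smoothOp (D : H →ₗ.[ℂ] H) (x : smoothDomain D) :
    ((x : H), (smoothOp D x : H)) ∈ D.graph :=
  D.mem_graph ⟨x, smoothDomain_le D x.2⟩

/-- `W^∞(D)` is a core for an operator `D` with non-empty resolvent set: the resolvent preserves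
`W^∞(D)`, hence carries vectors of `W^∞(D)` that approximate `(D - z) x` to vectors of `W^∞(D)`
that approximate `x` in the graph norm. -/
theorem graph_subset_closure_smooth {D : H →ₗ.[ℂ] H} (hR : HasCompactResolvent D)
    (hD : Dense (smoothDomain D : Set H)) :
    (D.graph : Set (H × H)) ⊆ closure {p | p ∈ D.graph ∧ p.1 ∈ smoothDomain D} := by
  obtain ⟨z, R, -, hR₁, hR₂⟩ := hR
  have hgraph : ∀ x, (R x, x + z • R x) ∈ D.graph := fun x => by
    obtain ⟨hx, h⟩ := hR₁ x
    have := D.mem_graph ⟨R x, hx⟩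
    rwa [sub_eq_iff_eq_add.1 h] at this
  have hsmooth : ∀ x ∈ smoothDomain D, R x ∈ smoothDomain D := fun x hx => by
    refine (Submodule.mem_iInf _).2 fun n => ?_
    induction n with
    | zero => exact Submodule.mem_top
    | succ n ih =>
      exact mem_powDomain_succ.2 ⟨_, Submodule.add_mem _ ((Submodule.mem_iInf _).1 hx n)
        (Submodule.smul_mem _ z ih), hgraph x⟩
  rintro ⟨x, y⟩ hxy
  obtain ⟨x', hx', hy'⟩ := (LinearPMap.mem_graph_iff D).1 hxy
  simp only at hx' hy'
  have hRx : R (y - z • x) = x := by rw [← hx', ← hy']; exact hR₂ x'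
  have hcont : Continuous fun t : H => (R t, t + z • R t) := by fun_prop
  have := map_mem_closure hcont (hD (y - z • x)) (t := {p | p ∈ D.graph ∧ p.1 ∈ smoothDomain D})
    fun t ht => ⟨hgraph t, hsmooth t ht⟩
  simpa [hRx] using this

end SmoothDomain

section Commutators

open ContinuousLinearMap (adjoint)

variable {H₁ H₂ H₃ : Type v}
  [NormedAddCommGroup H₁] [InnerProductSpace ℂ H₁] [CompleteSpace H₁]
  [NormedAddCommGroup H₂] [InnerProductSpace ℂ H₂] [CompleteSpace H₂]
  [NormedAddCommGroup H₃] [InnerProductSpace ℂ H₃] [CompleteSpace H₃]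
  {D₁ : H₁ →ₗ.[ℂ] H₁} {D₂ : H₂ →ₗ.[ℂ] H₂} {D₃ : H₃ →ₗ.[ℂ] H₃}

/-- In the graph of a self-adjoint operator lie exactly the pairs that satisfy the symmetry
relation with the whole graph. -/
theorem IsSelfAdjoint.mem_graph_iff {D : H₁ →ₗ.[ℂ] H₁} (hD : IsSelfAdjoint D) {a b : H₁} :
    (a, b) ∈ D.graph ↔ ∀ x y, (x, y) ∈ D.graph → ⟪b, x⟫_ℂ = ⟪a, y⟫_ℂ := by
  have hself := LinearPMap.isSelfAdjoint_def.1 hD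
  constructor
  · intro hab x y hxy
    have hform := LinearPMap.adjoint_isFormalAdjoint (T := D) hD.dense_domain
    rw [hself] at hform
    obtain ⟨a', rfl, rfl⟩ := (LinearPMap.mem_graph_iff D).1 hab
    obtain ⟨x', rfl, rfl⟩ := (LinearPMap.mem_graph_iff D).1 hxy
    exact hform a' x'
  · intro h
    have key : ∀ x : D.domain, ⟪b, (x : H₁)⟫_ℂ = ⟪a, D x⟫_ℂ := fun x => h _ _ (D.mem_graph x)
    have ha : a ∈ D.adjoint.domain := LinearPMap.mem_adjoint_domain_of_exists a ⟨b, key⟩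
    have hb : D.adjoint ⟨a, ha⟩ = b := LinearPMap.adjoint_apply_eq hD.dense_domain ⟨a, ha⟩ key
    have hab : (a, b) ∈ D.adjoint.graph := hb ▸ D.adjoint.mem_graph ⟨a, ha⟩
    rwa [hself] at hab

/-- `S` and its adjoint preserve the smooth domains of `D₁` and `D₂`. -/
structure IsSmooth (D₁ : H₁ →ₗ.[ℂ] H₁) (D₂ : H₂ →ₗ.[ℂ] H₂) (S : H₁ →L[ℂ] H₂) : Prop where
  map_smooth : ∀ h ∈ smoothDomain D₁, S h ∈ smoothDomain D₂
  adjoint_map_smooth : ∀ k ∈ smoothDomain D₂, adjoint S k ∈ smoothDomain D₁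

namespace IsSmooth

theorem adjoint {S : H₁ →L[ℂ] H₂} (hS : IsSmooth D₁ D₂ S) :
    IsSmooth D₂ D₁ (ContinuousLinearMap.adjoint S) where
  map_smooth := hS.adjoint_map_smooth
  adjoint_map_smooth := by simpa using hS.map_smooth

theorem comp {S : H₂ →L[ℂ] H₃} {T : H₁ →L[ℂ] H₂} (hS : IsSmooth D₂ D₃ S)
    (hT : IsSmooth D₁ D₂ T) : IsSmooth D₁ D₃ (S ∘L T) where
  map_smooth h hh := hS.map_smooth _ (hT.map_smooth h hh)
  adjoint_map_smooth k hk := by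
    rw [ContinuousLinearMap.adjoint_comp]
    exact hT.adjoint_map_smooth _ (hS.adjoint_map_smooth k hk)

theorem mem_boundedEnd {S : H₁ →L[ℂ] H₁} (hS : IsSmooth D₁ D₁ S) :
    S ∈ boundedEnd (smoothDomain D₁) :=
  fun h hh => ⟨hS.map_smooth h hh, hS.adjoint_map_smooth h hh⟩

end IsSmooth

/-- `T` is the commutator `D₂ S - S D₁` of a smooth operator `S`, on all of the domain of `D₁`. -/
structure IsCommutator (D₁ : H₁ →ₗ.[ℂ] H₁) (D₂ : H₂ →ₗ.[ℂ] H₂) (S T : H₁ →L[ℂ] H₂) : Prop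
    extends IsSmooth D₁ D₂ S where
  map_graph : ∀ x y, (x, y) ∈ D₁.graph → (S x, T x + S y) ∈ D₂.graph

namespace IsCommutator

theorem add {S S' T T' : H₁ →L[ℂ] H₂} (h : IsCommutator D₁ D₂ S T)
    (h' : IsCommutator D₁ D₂ S' T') : IsCommutator D₁ D₂ (S + S') (T + T') where
  map_smooth x hx := Submodule.add_mem _ (h.map_smooth x hx) (h'.map_smooth x hx)
  adjoint_map_smooth x hx := by
    rw [map_add]
    exact Submodule.add_mem _ (h.adjoint_map_smooth x hx) (h'.adjoint_map_smooth x hx)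
  map_graph x y hxy := by
    have := Submodule.add_mem _ (h.map_graph x y hxy) (h'.map_graph x y hxy)
    convert this using 1
    refine Prod.ext rfl ?_
    change T x + T' x + (S y + S' y) = (T x + S y) + (T' x + S' y)
    abel

theorem smul {S T : H₁ →L[ℂ] H₂} (h : IsCommutator D₁ D₂ S T) (c : ℂ) :
    IsCommutator D₁ D₂ (c • S) (c • T) where
  map_smooth x hx := Submodule.smul_mem _ c (h.map_smooth x hx)
  adjoint_map_smooth x hx := by
    rw [map_smulₛₗ]
    exact Submodule.smul_mem _ _ (h.adjoint_map_smooth x hx)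
  map_graph x y hxy := by
    have := Submodule.smul_mem _ c (h.map_graph x y hxy)
    convert this using 1
    exact Prod.ext rfl (smul_add c (T x) (S y)).symm

/-- The Leibniz rule. -/
theorem comp {S T : H₂ →L[ℂ] H₃} {S' T' : H₁ →L[ℂ] H₂} (h : IsCommutator D₂ D₃ S T)
    (h' : IsCommutator D₁ D₂ S' T') : IsCommutator D₁ D₃ (S ∘L S') (T ∘L S' + S ∘L T') where
  toIsSmooth := h.toIsSmooth.comp h'.toIsSmooth
  map_graph x y hxy := by
    have := h.map_graph _ _ (h'.map_graph x y hxy)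
    convert this using 1
    refine Prod.ext rfl ?_
    change T (S' x) + S (T' x) + S (S' y) = T (S' x) + S (T' x + S' y)
    rw [map_add, add_assoc]

theorem adjoint (hD₁ : IsSelfAdjoint D₁) (hD₂ : IsSelfAdjoint D₂) {S T : H₁ →L[ℂ] H₂}
    (h : IsCommutator D₁ D₂ S T) :
    IsCommutator D₂ D₁ (ContinuousLinearMap.adjoint S) (-ContinuousLinearMap.adjoint T) where
  toIsSmooth := h.toIsSmooth.adjoint
  map_graph k l hkl := by
    refine hD₁.mem_graph_iff.2 fun x y hxy => ?_
    have := hD₂.mem_graph_iff.1 hkl _ _ (h.map_graph x y hxy)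
    rw [inner_add_right] at this
    simp only [neg_apply, inner_add_left, inner_neg_left,
      ContinuousLinearMap.adjoint_inner_left, this]
    ring

theorem unique (hD : Dense (D₁.domain : Set H₁)) {S T T' : H₁ →L[ℂ] H₂}
    (h : IsCommutator D₁ D₂ S T) (h' : IsCommutator D₁ D₂ S T') : T = T' := by
  refine ContinuousLinearMap.ext fun x => congrFun (Continuous.ext_on hD T.continuous
    T'.continuous fun x hx => ?_) x
  have hx' := D₁.mem_graph ⟨x, hx⟩
  have := LinearPMap.mem_graph_snd_inj D₂ (h.map_graph _ _ hx') (h'.map_graph _ _ hx') rfl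
  exact add_right_cancel this

theorem map_smooth_commutator {S T : H₁ →L[ℂ] H₂} (h : IsCommutator D₁ D₂ S T) {x : H₁}
    (hx : x ∈ smoothDomain D₁) : T x ∈ smoothDomain D₂ := by
  have hg := graph_smoothOp D₁ ⟨x, hx⟩
  have h₁ := mem_smoothDomain_of_graph (h.map_graph _ _ hg) (h.map_smooth x hx)
  have h₂ := h.map_smooth _ (smoothOp D₁ ⟨x, hx⟩).2
  simpa using Submodule.sub_mem _ h₁ h₂

/-- The commutator itself is smooth. -/
theorem isSmooth (hD₁ : IsSelfAdjoint D₁) (hD₂ : IsSelfAdjoint D₂) {S T : H₁ →L[ℂ] H₂}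
    (h : IsCommutator D₁ D₂ S T) : IsSmooth D₁ D₂ T := by
  refine ⟨fun x => h.map_smooth_commutator, fun k hk => ?_⟩
  have := (h.adjoint hD₁ hD₂).map_smooth_commutator hk
  rw [neg_apply] at this
  simpa using Submodule.neg_mem _ this

end IsCommutator

end Commutators

/-- The commutators of a spectral triple, defined on the smooth domain, are commutators on the whole
domain of the Dirac operator, as the smooth domain is a core. -/
theorem UnitalSpectralTriple.isCommutator_rep (σ : UnitalSpectralTriple.{u, v}) (a : σ.A) :
    IsCommutator σ.D σ.D (σ.rep a) (σ.commutator a : σ.H →L[ℂ] σ.H) where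
  map_smooth h hh := σ.rep_smooth a h hh
  adjoint_map_smooth h hh := by
    rw [← ContinuousLinearMap.star_eq_adjoint, ← map_star]
    exact σ.rep_smooth _ h hh
  map_graph x y hxy := by
    let T := σ.commutatorCLM a
    have hcont : Continuous fun p : σ.H × σ.H => (σ.rep a p.1, T p.1 + σ.rep a p.2) := by fun_prop
    have hclosed : _root_.IsClosed (σ.D.graph : Set (σ.H × σ.H)) := σ.isSelfAdjoint.isClosed
    have := map_mem_closure hcont
      (graph_subset_closure_smooth σ.compactResolvent σ.dense_smooth hxy)
      (t := (σ.D.graph : Set (σ.H × σ.H))) ?_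
    · rwa [hclosed.closure_eq] at this
    · rintro ⟨x, y⟩ ⟨hxy, hx⟩
      have hg := graph_smoothOp σ.D ⟨x, hx⟩
      simp only at hx hg
      obtain rfl : y = smoothOp σ.D ⟨x, hx⟩ := LinearPMap.mem_graph_snd_inj _ hxy hg rfl
      have hT : T x = _ := σ.commutatorCLM_apply a ⟨x, hx⟩
      change (σ.rep a x, T x + σ.rep a (smoothOp σ.D ⟨x, hx⟩)) ∈ σ.D.graph
      rw [hT, sub_add_cancel]
      exact graph_smoothOp σ.D ⟨σ.rep a x, σ.rep_smooth a x hx⟩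

theorem UnitalSpectralTriple.commutator_eq (σ : UnitalSpectralTriple.{u, v}) {a : σ.A}
    {T : σ.H →L[ℂ] σ.H} (hT : IsCommutator σ.D σ.D (σ.rep a) T) :
    (σ.commutator a : σ.H →L[ℂ] σ.H) = T :=
  (σ.isCommutator_rep a).unique σ.isSelfAdjoint.dense_domain hT

/-! ### Elementary tensors -/

namespace BalTensor

variable {B A : Type u} [LCPreCStarAlgebra B] [LCPreCStarAlgebra A] {E : AlgBimodule B A}
  {M : Type v} [AddCommGroup M] [Module ℂ M] (ρ : A →ₐ[ℂ] Module.End ℂ M)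

theorem mk_apply (ξ : E) (m : M) : mk ρ ξ m = tmul ρ ξ m := rfl

theorem add_tmul (ξ η : E) (m : M) : tmul ρ (ξ + η) m = tmul ρ ξ m + tmul ρ η m := by
  simp only [← mk_apply, map_add, LinearMap.add_apply]

theorem tmul_add (ξ : E) (m n : M) : tmul ρ ξ (m + n) = tmul ρ ξ m + tmul ρ ξ n := by
  simp only [← mk_apply, map_add]

theorem sum_tmul {ι : Type*} (s : Finset ι) (ξ : ι → E) (m : M) :
    tmul ρ (∑ i ∈ s, ξ i) m = ∑ i ∈ s, tmul ρ (ξ i) m := by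
  simp only [← mk_apply, map_sum, LinearMap.sum_apply]

theorem tmul_smul (c : ℂ) (ξ : E) (m : M) : tmul ρ ξ (c • m) = c • tmul ρ ξ m := by
  simp only [← mk_apply, map_smul]

theorem induction_on {P : BalTensor E ρ → Prop} (t : BalTensor E ρ)
    (tmul : ∀ ξ m, P (tmul ρ ξ m)) (add : ∀ s t, P s → P t → P (s + t)) : P t := by
  obtain ⟨t, rfl⟩ := (balancedRelations E ρ).mkQ_surjective t
  induction t using TensorProduct.induction_on with
  | zero =>
    have := tmul 0 0
    rwa [BalTensor.tmul, TensorProduct.zero_tmul] at this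
  | tmul ξ m => exact tmul ξ m
  | add s t hs ht =>
    rw [map_add]
    exact add _ _ hs ht

/-- Linear maps on a balanced tensor product agree if they agree on elementary tensors. -/
theorem linearMap_ext {N : Type*} [AddCommGroup N] [Module ℂ N] {f g : BalTensor E ρ →ₗ[ℂ] N}
    (h : ∀ ξ m, f (tmul ρ ξ m) = g (tmul ρ ξ m)) (t : BalTensor E ρ) : f t = g t :=
  induction_on (P := fun t => f t = g t) ρ t h fun s t hs ht => by rw [map_add, map_add, hs, ht]

end BalTensor

namespace UnitalSpectralTriple

variable (σ : UnitalSpectralTriple.{u, v}) {B : Type u} [LCPreCStarAlgebra B]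
  {E : AlgBimodule B σ.A}

theorem rightMul_tmul (S : σ.BH) (ξ : E) (T : σ.BH) :
    σ.rightMul S (BalTensor.tmul σ.actBH ξ T) = BalTensor.tmul σ.actBH ξ (T * S) :=
  BalTensor.map_tmul ..

theorem eval_tmul (h : σ.H) (ξ : E) (T : σ.BH) :
    σ.eval h (BalTensor.tmul σ.actBH ξ T)
      = BalTensor.tmul σ.actH ξ ((T : σ.H →L[ℂ] σ.H) h) :=
  BalTensor.map_tmul ..

theorem gradingTensor_tmul (γ : σ.H →L[ℂ] σ.H) (hγ : γ ∈ σ.grading) (ξ : E) (h : σ.H) :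
    σ.gradingTensor γ hγ (BalTensor.tmul σ.actH ξ h) = BalTensor.tmul σ.actH ξ (γ h) :=
  BalTensor.map_tmul ..

theorem pairing_tmul (K : FiniteKasparov E) (ξ η : E) (T : σ.BH) :
    σ.pairing K ξ (BalTensor.tmul σ.actBH η T) = σ.repBH (K.inner ξ η) * T :=
  BalTensor.lift_tmul ..

end UnitalSpectralTriple

/-! ### Full inner products -/

section Full

variable {B A : Type u} [LCPreCStarAlgebra B] [LCPreCStarAlgebra A] {E : AlgBimodule B A}

theorem FiniteKasparov.exists_sum_inner_eq_one (K : FiniteKasparov E)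
    (hK : Submodule.span ℂ {a : A | ∃ x y : E, a = K.inner x y} = ⊤) :
    ∃ (n : ℕ) (u v : Fin n → E), ∑ i, K.inner (u i) (v i) = 1 := by
  have h1 : (1 : A) ∈ Submodule.span ℂ {a : A | ∃ x y : E, a = K.inner x y} := hK ▸ trivial
  obtain ⟨n, c, g, hg⟩ := Submodule.mem_span_set'.1 h1
  choose x y hxy using fun i => (g i).2
  refine ⟨n, x, fun i => op (algebraMap ℂ A (c i)) • y i, ?_⟩
  rw [← hg]
  refine Finset.sum_congr rfl fun i _ => ?_
  rw [map_smul, ← hxy, op_smul_eq_mul, ← Algebra.commutes, Algebra.smul_def]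

/-- A full left inner product yields a dual basis for the right inner product. -/
theorem EquivalenceBimodule.exists_dualBasis (K : EquivalenceBimodule E) :
    ∃ (n : ℕ) (u v : Fin n → E), ∑ i, K.left.inner (E.toConj (u i)) (E.toConj (v i)) = 1 ∧
      ∀ ξ, ∑ i, op (K.right.inner (v i) ξ) • u i = ξ := by
  obtain ⟨n, u, v, h⟩ := K.left.exists_sum_inner_eq_one K.full_left
  refine ⟨n, fun i => E.toConj.symm (u i), fun i => E.toConj.symm (v i), by simpa using h,
    fun ξ => ?_⟩
  simp only [← K.assoc, AddEquiv.apply_symm_apply, ← Finset.sum_smul, h, one_smul]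

end Full

/-! ### Dirac representations of equivalence bimodules -/

section DiracRepresentation

open ContinuousLinearMap (adjoint)

variable {σ τ : UnitalSpectralTriple.{u, v}} {E : AlgBimodule τ.A σ.A}

/-- A concrete form of Morita equivalence of spectral triples: a representation of an equivalence
bimodule `E` by bounded operators `L ξ` from the Hilbert space of `σ` to that of `τ` which turns
both inner products into products of operators, and for which all commutators of `L ξ` with the
Dirac operators are bounded. -/
structure IsDiracRepresentation (K : EquivalenceBimodule E) (L : E →ₗ[ℂ] σ.H →L[ℂ] τ.H) :
    Prop where
  map_right : ∀ ξ a, L (op a • ξ) = L ξ ∘L σ.rep a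
  map_left : ∀ b ξ, L (b • ξ) = τ.rep b ∘L L ξ
  adjoint_comp : ∀ ξ η, adjoint (L ξ) ∘L L η = σ.rep (K.right.inner ξ η)
  comp_adjoint : ∀ ξ η, L ξ ∘L adjoint (L η)
    = τ.rep (K.left.inner (E.toConj ξ) (E.toConj η))
  exists_commutator : ∀ ξ, ∃ T, IsCommutator σ.D τ.D (L ξ) T
  even_iff : σ.grading.isSome ↔ τ.grading.isSome
  map_grading : ∀ γ ∈ σ.grading, ∀ γ' ∈ τ.grading, ∀ ξ, L ξ ∘L γ = γ' ∘L L ξ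

/-- The map `ξ ⊗ h ↦ L ξ h` on `E ⊗_A H`. -/
noncomputable def applyTensor (L : E →ₗ[ℂ] σ.H →L[ℂ] τ.H)
    (hL : ∀ ξ a, L (op a • ξ) = L ξ ∘L σ.rep a) : BalTensor E σ.actH →ₗ[ℂ] τ.H :=
  BalTensor.lift σ.actH (ContinuousLinearMap.coeLM ℂ ∘ₗ L) fun ξ a h => by
    change L (op a • ξ) h = L ξ (σ.rep a h)
    rw [hL]
    rfl

theorem applyTensor_tmul (L : E →ₗ[ℂ] σ.H →L[ℂ] τ.H)
    (hL : ∀ ξ a, L (op a • ξ) = L ξ ∘L σ.rep a) (ξ : E) (h : σ.H) :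
    applyTensor L hL (BalTensor.tmul σ.actH ξ h) = L ξ h :=
  BalTensor.lift_tmul ..

/-- The map `ξ ⊗ T ↦ L ξ ∘ T` on `E ⊗_A B(𝓗)`. -/
noncomputable def compTensor (L : E →ₗ[ℂ] σ.H →L[ℂ] τ.H)
    (hL : ∀ ξ a, L (op a • ξ) = L ξ ∘L σ.rep a) :
    BalTensor E σ.actBH →ₗ[ℂ] σ.H →L[ℂ] τ.H :=
  BalTensor.lift σ.actBH
    (LinearMap.mk₂ ℂ (fun ξ (T : σ.BH) => L ξ ∘L (T : σ.H →L[ℂ] σ.H))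
      (fun ξ η T => by rw [map_add, ContinuousLinearMap.add_comp])
      (fun c ξ T => by rw [map_smul, ContinuousLinearMap.smul_comp])
      (fun ξ S T => ContinuousLinearMap.comp_add _ _ _)
      (fun c ξ T => ContinuousLinearMap.comp_smul _ _ _)) fun ξ a T => by
    change L (op a • ξ) ∘L (T : σ.H →L[ℂ] σ.H) = L ξ ∘L (σ.rep a ∘L (T : σ.H →L[ℂ] σ.H))
    rw [hL]
    rfl

theorem compTensor_tmul (L : E →ₗ[ℂ] σ.H →L[ℂ] τ.H)
    (hL : ∀ ξ a, L (op a • ξ) = L ξ ∘L σ.rep a) (ξ : E) (T : σ.BH) :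
    compTensor L hL (BalTensor.tmul σ.actBH ξ T) = L ξ ∘L (T : σ.H →L[ℂ] σ.H) :=
  BalTensor.lift_tmul ..

theorem applyTensor_eval (L : E →ₗ[ℂ] σ.H →L[ℂ] τ.H)
    (hL : ∀ ξ a, L (op a • ξ) = L ξ ∘L σ.rep a) (h : σ.H) (t : BalTensor E σ.actBH) :
    applyTensor L hL (σ.eval h t) = compTensor L hL t h := by
  induction t using BalTensor.induction_on with
  | tmul ξ T =>
    rw [compTensor_tmul, eval_tmul, applyTensor_tmul]
    rfl
  | add s t hs ht => rw [map_add, map_add, hs, ht, map_add]; rfl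

theorem compTensor_rightMul (L : E →ₗ[ℂ] σ.H →L[ℂ] τ.H)
    (hL : ∀ ξ a, L (op a • ξ) = L ξ ∘L σ.rep a) (S : σ.BH) (t : BalTensor E σ.actBH) :
    compTensor L hL (σ.rightMul S t) = compTensor L hL t ∘L (S : σ.H →L[ℂ] σ.H) := by
  induction t using BalTensor.induction_on with
  | tmul ξ T =>
    rw [compTensor_tmul, rightMul_tmul, compTensor_tmul]
    rfl
  | add s t hs ht => rw [map_add, map_add, hs, ht, map_add, ContinuousLinearMap.add_comp]

/-- Through `ξ ⊗ T ↦ L ξ ∘ T` the pairing with `ξ` is composition with the adjoint of `L ξ`. -/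
theorem coe_pairing {K : FiniteKasparov E} (L : E →ₗ[ℂ] σ.H →L[ℂ] τ.H)
    (hL : ∀ ξ a, L (op a • ξ) = L ξ ∘L σ.rep a)
    (hLL : ∀ ξ η, adjoint (L ξ) ∘L L η = σ.rep (K.inner ξ η)) (ξ : E)
    (t : BalTensor E σ.actBH) :
    (σ.pairing K ξ t : σ.H →L[ℂ] σ.H) = adjoint (L ξ) ∘L compTensor L hL t := by
  induction t using BalTensor.induction_on with
  | tmul η T =>
    rw [compTensor_tmul, pairing_tmul, ← ContinuousLinearMap.comp_assoc, hLL]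
    rfl
  | add s t hs ht =>
    rw [map_add, map_add, ContinuousLinearMap.comp_add, ← hs, ← ht]
    rfl

namespace IsDiracRepresentation

variable {K : EquivalenceBimodule E} {L : E →ₗ[ℂ] σ.H →L[ℂ] τ.H}

/-- The commutator `ξ ↦ D_τ L ξ - L ξ D_σ`. -/
noncomputable def commutator (hL : IsDiracRepresentation K L) : E →ₗ[ℂ] σ.H →L[ℂ] τ.H where
  toFun ξ := (hL.exists_commutator ξ).choose
  map_add' ξ η := by
    refine (hL.exists_commutator (ξ + η)).choose_spec.unique σ.isSelfAdjoint.dense_domain ?_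
    rw [map_add]
    exact (hL.exists_commutator ξ).choose_spec.add (hL.exists_commutator η).choose_spec
  map_smul' c ξ := by
    refine (hL.exists_commutator (c • ξ)).choose_spec.unique σ.isSelfAdjoint.dense_domain ?_
    rw [map_smul]
    exact (hL.exists_commutator ξ).choose_spec.smul c

theorem isCommutator (hL : IsDiracRepresentation K L) (ξ : E) :
    IsCommutator σ.D τ.D (L ξ) (hL.commutator ξ) :=
  (hL.exists_commutator ξ).choose_spec

theorem commutator_eq (hL : IsDiracRepresentation K L) {ξ : E} {T : σ.H →L[ℂ] τ.H}
    (hT : IsCommutator σ.D τ.D (L ξ) T) : hL.commutator ξ = T :=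
  (hL.isCommutator ξ).unique σ.isSelfAdjoint.dense_domain hT

theorem isSmooth_commutator (hL : IsDiracRepresentation K L) (ξ : E) :
    IsSmooth σ.D τ.D (hL.commutator ξ) :=
  (hL.isCommutator ξ).isSmooth σ.isSelfAdjoint τ.isSelfAdjoint

/-- `D_τ L ξ - L ξ D_σ` is odd: it anticommutes with the gradings. -/
theorem commutator_grading (hL : IsDiracRepresentation K L) {γ : σ.H →L[ℂ] σ.H}
    (hγ : γ ∈ σ.grading) {γ' : τ.H →L[ℂ] τ.H} (hγ' : γ' ∈ τ.grading) (ξ : E) (h : σ.H) :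
    hL.commutator ξ (γ h) = -γ' (hL.commutator ξ h) := by
  have hgr : ∀ (ρ : UnitalSpectralTriple.{u, v}) (γ : ρ.H →L[ℂ] ρ.H), γ ∈ ρ.grading →
      ∀ x y, (x, y) ∈ ρ.D.graph → (γ x, -γ y) ∈ ρ.D.graph := fun ρ γ hγ x y hxy => by
    obtain ⟨x', rfl, rfl⟩ := (LinearPMap.mem_graph_iff ρ.D).1 hxy
    obtain ⟨hx, h⟩ := ρ.grading_D γ hγ x'
    rw [← h]
    exact ρ.D.mem_graph ⟨_, hx⟩
  have hcomm : ∀ x, L ξ (γ x) = γ' (L ξ x) := fun x =>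
    congrArg (fun T : σ.H →L[ℂ] τ.H => T x) (hL.map_grading γ hγ γ' hγ' ξ)
  refine congrFun (Continuous.ext_on σ.isSelfAdjoint.dense_domain
    ((hL.commutator ξ).continuous.comp γ.continuous)
    (γ'.continuous.comp (hL.commutator ξ).continuous).neg fun x hx => ?_) h
  have hx' := σ.D.mem_graph ⟨x, hx⟩
  have h₁ := (hL.isCommutator ξ).map_graph _ _ (hgr σ γ hγ _ _ hx')
  have h₂ := hgr τ γ' hγ' _ _ ((hL.isCommutator ξ).map_graph _ _ hx')
  have := LinearPMap.mem_graph_snd_inj _ h₁ h₂ (hcomm x)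
  simp only [map_neg, map_add, hcomm, neg_add] at this
  exact add_right_cancel this

end IsDiracRepresentation

end DiracRepresentation

/-! ### From Dirac representations to connections -/

section ToConnection

open ContinuousLinearMap (adjoint)

variable {σ τ : UnitalSpectralTriple.{u, v}} {E : AlgBimodule τ.A σ.A}
  {K : EquivalenceBimodule E} {L : E →ₗ[ℂ] σ.H →L[ℂ] τ.H}

namespace IsDiracRepresentation

theorem adjoint_apply (hL : IsDiracRepresentation K L) (ξ η : E) (h : σ.H) :
    adjoint (L ξ) (L η h) = σ.rep (K.right.inner ξ η) h :=
  congrArg (fun T : σ.H →L[ℂ] σ.H => T h) (hL.adjoint_comp ξ η)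

/-- A dual basis of `E` resolves the identity of the Hilbert space of `τ`. -/
theorem sum_comp_adjoint (hL : IsDiracRepresentation K L) {n : ℕ} {u v : Fin n → E}
    (huv : ∑ i, K.left.inner (E.toConj (u i)) (E.toConj (v i)) = 1) :
    ∑ i, L (u i) ∘L adjoint (L (v i)) = 1 := by
  simp only [hL.comp_adjoint, ← map_sum, huv, map_one]

theorem applyTensor_injective (hL : IsDiracRepresentation K L) :
    Function.Injective (applyTensor L hL.map_right) := by
  obtain ⟨n, u, v, -, huv⟩ := K.exists_dualBasis
  let J : τ.H →ₗ[ℂ] BalTensor E σ.actH :=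
    ∑ i, BalTensor.mk σ.actH (u i) ∘ₗ (adjoint (L (v i)) : τ.H →ₗ[ℂ] σ.H)
  refine Function.LeftInverse.injective (g := J) fun t => ?_
  refine BalTensor.linearMap_ext (f := J ∘ₗ applyTensor L hL.map_right) (g := LinearMap.id)
    σ.actH (fun ξ h => ?_) t
  rw [LinearMap.comp_apply, applyTensor_tmul, LinearMap.sum_apply, LinearMap.id_apply]
  conv_rhs => rw [← huv ξ, BalTensor.sum_tmul]
  refine Finset.sum_congr rfl fun i _ => ?_
  change BalTensor.tmul σ.actH (u i) (adjoint (L (v i)) (L ξ h)) = _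
  rw [hL.adjoint_apply, BalTensor.smul_tmul]
  rfl

theorem applyTensor_surjective (hL : IsDiracRepresentation K L) :
    Function.Surjective (applyTensor L hL.map_right) := fun k => by
  obtain ⟨n, u, v, huv, -⟩ := K.exists_dualBasis
  refine ⟨∑ i, BalTensor.tmul σ.actH (u i) (adjoint (L (v i)) k), ?_⟩
  simp only [map_sum, applyTensor_tmul]
  simpa using congrArg (fun T : τ.H →L[ℂ] τ.H => T k) (hL.sum_comp_adjoint huv)

theorem compTensor_injective (hL : IsDiracRepresentation K L) :
    Function.Injective (compTensor L hL.map_right) := by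
  obtain ⟨n, u, v, -, huv⟩ := K.exists_dualBasis
  refine (injective_iff_map_eq_zero _).2 fun t ht => ?_
  -- The pairings with the `v i` determine `t`.
  let J : BalTensor E σ.actBH →ₗ[ℂ] BalTensor E σ.actBH :=
    ∑ i, BalTensor.mk σ.actBH (u i) ∘ₗ σ.pairing K.right (v i)
  have hJ : J t = t := by
    refine BalTensor.linearMap_ext (g := LinearMap.id) σ.actBH (fun ξ T => ?_) t
    rw [LinearMap.sum_apply, LinearMap.id_apply]
    conv_rhs => rw [← huv ξ, BalTensor.sum_tmul]
    refine Finset.sum_congr rfl fun i _ => ?_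
    change BalTensor.tmul σ.actBH (u i) (σ.pairing K.right (v i) (BalTensor.tmul σ.actBH ξ T)) = _
    rw [pairing_tmul, BalTensor.smul_tmul]
    rfl
  have hp : ∀ i, σ.pairing K.right (v i) t = 0 := fun i => Subtype.ext <| by
    rw [coe_pairing L hL.map_right hL.adjoint_comp, ht, ContinuousLinearMap.comp_zero]
    rfl
  rw [← hJ, LinearMap.sum_apply]
  refine Finset.sum_eq_zero fun i _ => ?_
  rw [LinearMap.comp_apply, hp, map_zero]

/-- Every smooth operator arises from `E ⊗_A B(𝓗)`. -/
theorem exists_compTensor_eq (hL : IsDiracRepresentation K L) {S : σ.H →L[ℂ] τ.H}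
    (hS : IsSmooth σ.D τ.D S) : ∃ t, compTensor L hL.map_right t = S := by
  obtain ⟨n, u, v, huv, -⟩ := K.exists_dualBasis
  refine ⟨∑ i, BalTensor.tmul σ.actBH (u i) ⟨adjoint (L (v i)) ∘L S,
    ((hL.isCommutator (v i)).toIsSmooth.adjoint.comp hS).mem_boundedEnd⟩, ?_⟩
  simp only [map_sum, compTensor_tmul, ← ContinuousLinearMap.comp_assoc]
  rw [← ContinuousLinearMap.finsetSum_comp, hL.sum_comp_adjoint huv]
  rfl

/-- The unitary operator `ξ ⊗ h ↦ L ξ h`. -/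
noncomputable def applyEquiv (hL : IsDiracRepresentation K L) : BalTensor E σ.actH ≃ₗ[ℂ] τ.H :=
  LinearEquiv.ofBijective (applyTensor L hL.map_right)
    ⟨hL.applyTensor_injective, hL.applyTensor_surjective⟩

theorem applyEquiv_tmul (hL : IsDiracRepresentation K L) (ξ : E) (h : σ.H) :
    hL.applyEquiv (BalTensor.tmul σ.actH ξ h) = L ξ h :=
  applyTensor_tmul L hL.map_right ξ h

/-- The map `∇` for which `ξ ⊗ T ↦ L ξ ∘ T` carries `∇ ξ` to the commutator of `L ξ` with the
Dirac operators. -/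
noncomputable def nabla (hL : IsDiracRepresentation K L) : E →ₗ[ℂ] BalTensor E σ.actBH where
  toFun ξ := (hL.exists_compTensor_eq (hL.isSmooth_commutator ξ)).choose
  map_add' ξ η := hL.compTensor_injective <| by
    have h := fun ξ => (hL.exists_compTensor_eq (hL.isSmooth_commutator ξ)).choose_spec
    exact (h _).trans ((map_add _ ξ η).trans ((congrArg₂ (· + ·) (h ξ) (h η)).symm.trans
      (map_add _ _ _).symm))
  map_smul' c ξ := hL.compTensor_injective <| by
    have h := fun ξ => (hL.exists_compTensor_eq (hL.isSmooth_commutator ξ)).choose_spec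
    exact (h _).trans ((map_smul _ c ξ).trans ((congrArg (c • ·) (h ξ)).symm.trans
      (map_smul _ c _).symm))

theorem compTensor_nabla (hL : IsDiracRepresentation K L) (ξ : E) :
    compTensor L hL.map_right (hL.nabla ξ) = hL.commutator ξ :=
  (hL.exists_compTensor_eq (hL.isSmooth_commutator ξ)).choose_spec

theorem applyEquiv_eval (hL : IsDiracRepresentation K L) (h : σ.H) (ξ : E) :
    hL.applyEquiv (σ.eval h (hL.nabla ξ)) = hL.commutator ξ h := by
  rw [← hL.compTensor_nabla]
  exact applyTensor_eval ..

/-- The connection of a Dirac representation.  Its defining identities are the Leibniz rule for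
the commutators of `L (ξ a) = L ξ a` and of `(L ξ)* L ε = (ξ, ε)` with the Dirac operators. -/
noncomputable def connection (hL : IsDiracRepresentation K L) : SigmaConnection σ K.right where
  nabla := hL.nabla
  leibniz ξ a := hL.compTensor_injective <| by
    rw [map_add, compTensor_nabla, compTensor_rightMul, compTensor_nabla, compTensor_tmul]
    refine hL.commutator_eq ?_
    rw [hL.map_right]
    exact (hL.isCommutator ξ).comp (σ.isCommutator_rep a)
  hermitian ξ ε := Subtype.ext <| by
    have hp : ∀ η ζ, (σ.pairing K.right η (hL.nabla ζ) : σ.H →L[ℂ] σ.H)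
        = adjoint (L η) ∘L hL.commutator ζ := fun η ζ => by
      rw [coe_pairing L hL.map_right hL.adjoint_comp, hL.compTensor_nabla]
    have h := ((hL.isCommutator ξ).adjoint σ.isSelfAdjoint τ.isSelfAdjoint).comp
      (hL.isCommutator ε)
    rw [hL.adjoint_comp] at h
    rw [σ.commutator_eq h, ContinuousLinearMap.neg_comp, neg_add_eq_sub]
    change (σ.pairing K.right ξ (hL.nabla ε) : σ.H →L[ℂ] σ.H)
      - adjoint (σ.pairing K.right ε (hL.nabla ξ) : σ.H →L[ℂ] σ.H) = _
    rw [hp, hp, ContinuousLinearMap.adjoint_comp, ContinuousLinearMap.adjoint_adjoint]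
  odd γ hγ ξ h := hL.applyEquiv.injective <| by
    obtain ⟨γ', hγ'⟩ := Option.isSome_iff_exists.1
      (hL.even_iff.1 (Option.isSome_iff_exists.2 ⟨γ, hγ⟩))
    have hg : ∀ t, hL.applyEquiv (σ.gradingTensor γ hγ t) = γ' (hL.applyEquiv t) := fun t => by
      refine BalTensor.linearMap_ext σ.actH
        (f := (hL.applyEquiv : BalTensor E σ.actH →ₗ[ℂ] τ.H) ∘ₗ σ.gradingTensor γ hγ)
        (g := (γ' : τ.H →ₗ[ℂ] τ.H) ∘ₗ (hL.applyEquiv : BalTensor E σ.actH →ₗ[ℂ] τ.H))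
        (fun ξ h => ?_) t
      change hL.applyEquiv (σ.gradingTensor γ hγ (BalTensor.tmul σ.actH ξ h))
        = γ' (hL.applyEquiv (BalTensor.tmul σ.actH ξ h))
      rw [gradingTensor_tmul, applyEquiv_tmul, applyEquiv_tmul]
      exact congrArg (fun T : σ.H →L[ℂ] τ.H => T h) (hL.map_grading γ hγ γ' hγ' ξ)
    rw [map_neg, hg, hL.applyEquiv_eval, hL.applyEquiv_eval, hL.commutator_grading hγ hγ']

theorem map_twistSmooth (hL : IsDiracRepresentation K L) :
    (twistSmooth E).map (hL.applyEquiv : BalTensor E σ.actH →ₗ[ℂ] τ.H) = smoothDomain τ.D := by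
  refine le_antisymm ?_ fun k hk => ?_
  · rw [twistSmooth, Submodule.map_span, Submodule.span_le]
    rintro _ ⟨_, ⟨ξ, h, rfl⟩, rfl⟩
    change hL.applyEquiv (BalTensor.tmul σ.actH ξ (h : σ.H)) ∈ smoothDomain τ.D
    rw [applyEquiv_tmul]
    exact (hL.isCommutator ξ).map_smooth _ h.2
  · obtain ⟨n, u, v, huv, -⟩ := K.exists_dualBasis
    refine ⟨∑ i, BalTensor.tmul σ.actH (u i) (adjoint (L (v i)) k), ?_, ?_⟩
    · exact Submodule.sum_mem _ fun i _ => Submodule.subset_span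
        ⟨u i, ⟨_, (hL.isCommutator (v i)).adjoint_map_smooth k hk⟩, rfl⟩
    · rw [LinearEquiv.coe_coe, map_sum]
      simp only [applyEquiv_tmul]
      simpa using congrArg (fun T : τ.H →L[ℂ] τ.H => T k) (hL.sum_comp_adjoint huv)

theorem map_twistGraph (hL : IsDiracRepresentation K L) :
    (twistGraph E hL.connection).map
      ((hL.applyEquiv : BalTensor E σ.actH →ₗ[ℂ] τ.H).prodMap
        (hL.applyEquiv : BalTensor E σ.actH →ₗ[ℂ] τ.H)) = τ.D.graph := by
  have hle : (twistGraph E hL.connection).map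
      ((hL.applyEquiv : BalTensor E σ.actH →ₗ[ℂ] τ.H).prodMap
        (hL.applyEquiv : BalTensor E σ.actH →ₗ[ℂ] τ.H)) ≤ τ.D.graph := by
    rw [twistGraph, Submodule.map_span, Submodule.span_le]
    rintro _ ⟨_, ⟨ξ, h, rfl⟩, rfl⟩
    change (hL.applyEquiv (BalTensor.tmul σ.actH ξ (h : σ.H)),
      hL.applyEquiv (BalTensor.tmul σ.actH ξ (σ.D h) + σ.eval (h : σ.H) (hL.nabla ξ)))
        ∈ τ.D.graph
    rw [map_add, applyEquiv_tmul, applyEquiv_tmul, hL.applyEquiv_eval, add_comm]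
    exact (hL.isCommutator ξ).map_graph _ _ (σ.D.mem_graph h)
  refine le_antisymm hle ?_
  -- It suffices to find an element of the left-hand side with a given first component.
  rintro ⟨k, l⟩ hkl
  obtain ⟨n, u, v, huv, -⟩ := K.exists_dualBasis
  have hdom : ∀ i, adjoint (L (v i)) k ∈ σ.D.domain := fun i => σ.D.mem_domain_of_mem_graph
    (((hL.isCommutator (v i)).adjoint σ.isSelfAdjoint τ.isSelfAdjoint).map_graph k l hkl)
  let p : BalTensor E σ.actH × BalTensor E σ.actH :=
    ∑ i, (BalTensor.tmul σ.actH (u i) (adjoint (L (v i)) k),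
      BalTensor.tmul σ.actH (u i) (σ.D ⟨_, hdom i⟩)
        + σ.eval (adjoint (L (v i)) k) (hL.connection.nabla (u i)))
  have hp : p ∈ twistGraph E hL.connection := Submodule.sum_mem _ fun i _ =>
    Submodule.subset_span ⟨u i, ⟨_, hdom i⟩, rfl⟩
  have hpk : hL.applyEquiv p.1 = k := by
    rw [Prod.fst_sum, map_sum]
    simp only [applyEquiv_tmul]
    simpa using congrArg (fun T : τ.H →L[ℂ] τ.H => T k) (hL.sum_comp_adjoint huv)
  have hmem := hle (Submodule.mem_map_of_mem hp)
  refine ⟨p, hp, Prod.ext hpk ?_⟩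
  exact LinearPMap.mem_graph_snd_inj _ hmem hkl hpk

theorem isUnitaryEquivTwist (hL : IsDiracRepresentation K L) :
    IsUnitaryEquivTwist σ τ hL.connection hL.applyEquiv where
  inner_map ξ ε h k := by
    rw [applyEquiv_tmul, applyEquiv_tmul, ← hL.adjoint_apply,
      ContinuousLinearMap.adjoint_inner_right]
  map_smooth := hL.map_twistSmooth
  map_rep b ξ h := by
    rw [applyEquiv_tmul, applyEquiv_tmul, hL.map_left]
    rfl
  map_dirac := hL.map_twistGraph
  even_iff := hL.even_iff
  map_grading γ hγ γ' hγ' ξ h := by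
    rw [applyEquiv_tmul, applyEquiv_tmul]
    exact congrArg (fun T : σ.H →L[ℂ] τ.H => T h) (hL.map_grading γ hγ γ' hγ' ξ)

end IsDiracRepresentation

end ToConnection

/-! ### From unitary equivalences to Dirac representations -/

namespace IsUnitaryEquivTwist

open ContinuousLinearMap (adjoint)

variable {σ τ : UnitalSpectralTriple.{u, v}} {E : AlgBimodule τ.A σ.A}
  {K : EquivalenceBimodule E} {C : SigmaConnection σ K.right}
  {U : BalTensor E σ.actH ≃ₗ[ℂ] τ.H}

/-- The bounded operators `h ↦ U (ξ ⊗ h)`. -/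
noncomputable def creation (hU : IsUnitaryEquivTwist σ τ C U) : E →ₗ[ℂ] σ.H →L[ℂ] τ.H where
  toFun ξ := LinearMap.mkContinuous ((U : BalTensor E σ.actH →ₗ[ℂ] τ.H) ∘ₗ BalTensor.mk σ.actH ξ)
    √‖σ.rep (K.right.inner ξ ξ)‖ fun h => by
      change ‖U (BalTensor.tmul σ.actH ξ h)‖ ≤ _
      refine abs_le_of_sq_le_sq' ?_ (by positivity) |>.2
      rw [mul_pow, Real.sq_sqrt (norm_nonneg _), ← inner_self_eq_norm_sq (𝕜 := ℂ), hU.inner_map]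
      refine (RCLike.re_le_norm _).trans ((norm_inner_le_norm _ _).trans ?_)
      have := (σ.rep (K.right.inner ξ ξ)).le_opNorm h
      nlinarith [norm_nonneg h]
  map_add' ξ η := ContinuousLinearMap.ext fun h => by
    change U (BalTensor.tmul σ.actH (ξ + η) h)
      = U (BalTensor.tmul σ.actH ξ h) + U (BalTensor.tmul σ.actH η h)
    rw [BalTensor.add_tmul, map_add]
  map_smul' c ξ := ContinuousLinearMap.ext fun h => by
    change U (BalTensor.mk σ.actH (c • ξ) h) = c • U (BalTensor.mk σ.actH ξ h)
    rw [map_smul, LinearMap.smul_apply, map_smul]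

theorem creation_apply (hU : IsUnitaryEquivTwist σ τ C U) (ξ : E) (h : σ.H) :
    hU.creation ξ h = U (BalTensor.tmul σ.actH ξ h) := rfl

theorem creation_map_right (hU : IsUnitaryEquivTwist σ τ C U) (ξ : E) (a : σ.A) :
    hU.creation (op a • ξ) = hU.creation ξ ∘L σ.rep a := ContinuousLinearMap.ext fun h =>
  congrArg U (BalTensor.smul_tmul σ.actH ξ a h)

theorem adjoint_creation (hU : IsUnitaryEquivTwist σ τ C U) (ξ η : E) (h : σ.H) :
    adjoint (hU.creation ξ) (U (BalTensor.tmul σ.actH η h)) = σ.rep (K.right.inner ξ η) h := by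
  refine ext_inner_left ℂ fun k => ?_
  rw [ContinuousLinearMap.adjoint_inner_right, creation_apply, hU.inner_map]

theorem applyTensor_creation (hU : IsUnitaryEquivTwist σ τ C U) (t : BalTensor E σ.actH) :
    applyTensor hU.creation hU.creation_map_right t = U t :=
  BalTensor.linearMap_ext σ.actH (g := (U : BalTensor E σ.actH →ₗ[ℂ] τ.H))
    (fun ξ h => applyTensor_tmul hU.creation hU.creation_map_right ξ h) t

/-- The description of the Dirac operator of `τ` as `D^E` says that `∇ ξ` acts as the commutator of
`h ↦ U (ξ ⊗ h)` with the Dirac operators. -/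
theorem isCommutator_creation (hU : IsUnitaryEquivTwist σ τ C U) (ξ : E) :
    IsCommutator σ.D τ.D (hU.creation ξ)
      (compTensor hU.creation hU.creation_map_right (C.nabla ξ)) where
  map_smooth h hh := by
    rw [← hU.map_smooth]
    exact Submodule.mem_map_of_mem (Submodule.subset_span ⟨ξ, ⟨h, hh⟩, rfl⟩)
  adjoint_map_smooth k hk := by
    rw [← hU.map_smooth] at hk
    obtain ⟨t, ht, rfl⟩ := hk
    rw [SetLike.mem_coe, twistSmooth] at ht
    change adjoint (hU.creation ξ) (U t) ∈ smoothDomain σ.D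
    induction ht using Submodule.span_induction with
    | mem t ht =>
      obtain ⟨η, h, rfl⟩ := ht
      rw [adjoint_creation]
      exact σ.rep_smooth _ _ h.2
    | zero => simp
    | add s t _ _ hs ht =>
      rw [map_add, map_add]
      exact Submodule.add_mem _ hs ht
    | smul c t _ ht =>
      rw [map_smul, map_smul]
      exact Submodule.smul_mem _ c ht
  map_graph x y hxy := by
    obtain ⟨x, rfl, rfl⟩ := (LinearPMap.mem_graph_iff σ.D).1 hxy
    rw [← applyTensor_eval, applyTensor_creation, creation_apply, creation_apply, ← hU.map_dirac,
      ← map_add, add_comm]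
    exact ⟨(BalTensor.tmul σ.actH ξ (x : σ.H), BalTensor.tmul σ.actH ξ (σ.D x)
      + σ.eval (x : σ.H) (C.nabla ξ)), Submodule.subset_span ⟨ξ, x, rfl⟩, rfl⟩

theorem isDiracRepresentation (hU : IsUnitaryEquivTwist σ τ C U) :
    IsDiracRepresentation K hU.creation where
  map_right := hU.creation_map_right
  map_left b ξ := ContinuousLinearMap.ext fun h => hU.map_rep b ξ h
  adjoint_comp ξ η := ContinuousLinearMap.ext fun h => hU.adjoint_creation ξ η h
  comp_adjoint ξ η := ContinuousLinearMap.ext fun k => by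
    obtain ⟨t, rfl⟩ := U.surjective k
    refine BalTensor.linearMap_ext σ.actH
      (f := (hU.creation ξ ∘L adjoint (hU.creation η) : τ.H →ₗ[ℂ] τ.H) ∘ₗ
        (U : BalTensor E σ.actH →ₗ[ℂ] τ.H))
      (g := (τ.rep (K.left.inner (E.toConj ξ) (E.toConj η)) : τ.H →ₗ[ℂ] τ.H) ∘ₗ
        (U : BalTensor E σ.actH →ₗ[ℂ] τ.H)) (fun ζ h => ?_) t
    change hU.creation ξ (adjoint (hU.creation η) (U (BalTensor.tmul σ.actH ζ h)))
      = τ.rep (K.left.inner (E.toConj ξ) (E.toConj η)) (U (BalTensor.tmul σ.actH ζ h))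
    rw [adjoint_creation, creation_apply, ← hU.map_rep, K.assoc, BalTensor.smul_tmul]
    rfl
  exists_commutator ξ := ⟨_, hU.isCommutator_creation ξ⟩
  even_iff := hU.even_iff
  map_grading γ hγ γ' hγ' ξ := ContinuousLinearMap.ext fun h => hU.map_grading γ hγ γ' hγ' ξ h

theorem commutator_creation (hU : IsUnitaryEquivTwist σ τ C U) (ξ : E) :
    hU.isDiracRepresentation.commutator ξ
      = compTensor hU.creation hU.creation_map_right (C.nabla ξ) :=
  hU.isDiracRepresentation.commutator_eq (hU.isCommutator_creation ξ)

end IsUnitaryEquivTwist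

/-! ### Frames of finite Kasparov modules -/

section Frames

variable {B A : Type u} [LCPreCStarAlgebra B] [LCPreCStarAlgebra A] {E : AlgBimodule B A}

namespace FiniteKasparov

theorem inner_op_smul_left (K : FiniteKasparov E) (a : A) (x y : E) :
    K.inner (op a • x) y = star a * K.inner x y := by
  rw [K.inner_star, map_smul, op_smul_eq_mul, star_mul, ← K.inner_star]

theorem inner_add_left (K : FiniteKasparov E) (x x' y : E) :
    K.inner (x + x') y = K.inner x y + K.inner x' y := by
  rw [K.inner_star, map_add, star_add, ← K.inner_star, ← K.inner_star]

/-- The columns of the projection `p` form a frame of `p Aⁿ`. -/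
theorem exists_frame (K : FiniteKasparov E) :
    ∃ (n : ℕ) (e : Fin n → E), ∀ x, ∑ i, op (K.inner (e i) x) • e i = x := by
  obtain ⟨n, p, φ, hp, hinj, hrange, hφ, -⟩ := K.finite_projective
  have hcol : ∀ j, ∃ e, φ e = fun i => p i j := fun j => by
    have : (fun i => p i j) ∈ Set.range φ := by
      rw [hrange, Set.mem_ofPred_eq]
      exact funext fun i => congrFun (congrFun hp.isIdempotentElem i) j
    exact this
  choose e he using hcol
  refine ⟨n, e, fun x => hinj ?_⟩
  have hx : p.mulVec (φ x) = φ x := by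
    have : φ x ∈ Set.range φ := ⟨x, rfl⟩
    rwa [hrange] at this
  have hpj : ∀ i j, star (p i j) = p j i := fun i j =>
    congrFun (congrFun hp.isSelfAdjoint j) i
  have hinner : ∀ j, K.inner (e j) x = φ x j := fun j => by
    simp only [hφ, he, hpj]
    exact congrFun hx j
  funext i
  simp only [hinner, map_sum, map_smul, he, Finset.sum_apply, Pi.smul_apply, op_smul_eq_mul]
  exact congrFun hx i

/-- The coefficients `b ↦ (x, b y)` of the left action are norm-bounded. -/
theorem exists_norm_inner_smul_le (K : FiniteKasparov E) (x y : E) :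
    ∃ C : ℝ, ∀ b : B, ‖K.inner x (b • y)‖ ≤ C * ‖b‖ := by
  obtain ⟨n, p, φ, -, -, -, hφ, -⟩ := K.finite_projective
  obtain ⟨C, hC⟩ := K.norm_smul
  refine ⟨∑ i, ‖φ x i‖ * √(|C| * ‖K.inner y y‖), fun b => ?_⟩
  have hb : ∀ i, ‖φ (b • y) i‖ ≤ √(|C| * ‖K.inner y y‖) * ‖b‖ := fun i => by
    refine abs_le_of_sq_le_sq' ?_ (by positivity) |>.2
    rw [mul_pow, Real.sq_sqrt (by positivity)]
    have h := sq_norm_le_norm_sum_star_mul_self (φ (b • y)) i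
    rw [← hφ] at h
    refine h.trans ((hC b y).trans ?_)
    calc C * ‖b‖ ^ 2 * ‖K.inner y y‖ ≤ |C| * ‖b‖ ^ 2 * ‖K.inner y y‖ := by
          gcongr
          exact le_abs_self C
      _ = _ := by ring
  rw [hφ, Finset.sum_mul]
  refine norm_sum_le_of_le _ fun i _ => (norm_mul_le _ _).trans ?_
  rw [norm_star, mul_assoc]
  exact mul_le_mul_of_nonneg_left (hb i) (norm_nonneg _)

/-- The coefficients `b ↦ (x, b y)` of the left action are continuous for the locally convex
topologies. -/
theorem continuous_inner_smul (K : FiniteKasparov E) (x y : E) :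
    @Continuous B A LCPreCStarAlgebra.lcTop LCPreCStarAlgebra.lcTop
      fun b => K.inner x (b • y) := by
  obtain ⟨n, p, φ, -, -, -, hφ, hind⟩ := K.finite_projective
  let _ : TopologicalSpace A := LCPreCStarAlgebra.lcTop
  let _ : TopologicalSpace B := LCPreCStarAlgebra.lcTop
  let _ : TopologicalSpace E := K.top
  have : IsTopologicalRing A := LCPreCStarAlgebra.lcTop_ring
  have hsmul : Continuous fun b : B => b • y :=
    K.jointly_continuous.comp (continuous_id.prodMk continuous_const)
  have hcoord : Continuous fun b : B => φ (b • y) := hind.continuous.comp hsmul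
  simp only [hφ]
  exact continuous_finsetSum _ fun i _ => continuous_const.mul ((continuous_apply i).comp hcoord)

/-- An inner product with a finite frame, for which the left action is by adjoints and has bounded
and continuous coefficients `b ↦ (x, b y)`, defines a finite Kasparov module: in the coordinates
`x ↦ (e i, x)` the action of `b` is the matrix with entries `(e i, b (e j))`. -/
def ofFrame (inner : E → (E →ₗ[Aᵐᵒᵖ] A)) (inner_star : ∀ x y, inner x y = star (inner y x))
    (inner_smul : ∀ (b : B) (x y : E), inner (b • x) y = inner x (star b • y))
    {n : ℕ} (e : Fin n → E) (he : ∀ x, ∑ i, op (inner (e i) x) • e i = x)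
    (hbound : ∀ x y, ∃ C : ℝ, ∀ b : B, ‖inner x (b • y)‖ ≤ C * ‖b‖)
    (hcont : ∀ x y, @Continuous B A LCPreCStarAlgebra.lcTop LCPreCStarAlgebra.lcTop
      fun b => inner x (b • y)) : FiniteKasparov E :=
  have hsum : ∀ x y, inner x y = ∑ i, star (inner (e i) x) * inner (e i) y := fun x y => by
    conv_lhs => rw [← he y, map_sum]
    refine Finset.sum_congr rfl fun i _ => ?_
    rw [map_smul, op_smul_eq_mul, inner_star x]
  have hcoord : ∀ (b : B) (x : E) (i : Fin n),
      inner (e i) (b • x) = ∑ j, inner (e i) (b • e j) * inner (e j) x := fun b x i => by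
    conv_lhs => rw [← he x, Finset.smul_sum, map_sum]
    refine Finset.sum_congr rfl fun j _ => ?_
    rw [smul_comm, map_smul, op_smul_eq_mul]
  { inner := inner
    inner_star := inner_star
    inner_self_pos := fun x => by
      rw [hsum]
      exact subset_closure (AddSubmonoid.sum_mem _ fun i _ =>
        AddSubmonoid.subset_closure ⟨inner (e i) x, rfl⟩)
    inner_self_eq_zero := fun x hx => by
      have h : ∀ i, inner (e i) x = 0 := fun i => by
        have := sq_norm_le_norm_sum_star_mul_self (fun i => inner (e i) x) i
        rw [← hsum, hx, norm_zero] at this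
        exact norm_eq_zero.1 (pow_eq_zero_iff two_ne_zero |>.1
          (le_antisymm this (sq_nonneg _)))
      rw [← he x]
      simp [h]
    top := @TopologicalSpace.induced E (Fin n → A) (fun x i => inner (e i) x)
      (@Pi.topologicalSpace (Fin n) (fun _ => A) fun _ => LCPreCStarAlgebra.lcTop)
    finite_projective := by
      refine ⟨n, Matrix.of fun i j => inner (e i) (e j), LinearMap.pi fun i => inner (e i),
        ⟨?_, ?_⟩, ?_, ?_, hsum, ?_⟩
      · ext i j
        conv_rhs => rw [Matrix.of_apply, ← he (e j), map_sum]
        rw [Matrix.mul_apply]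
        refine Finset.sum_congr rfl fun k _ => ?_
        rw [map_smul, op_smul_eq_mul]
        rfl
      · ext i j
        exact (inner_star _ _).symm
      · refine (injective_iff_map_eq_zero _).2 fun x hx => ?_
        rw [← he x]
        refine Finset.sum_eq_zero fun i _ => ?_
        have : inner (e i) x = 0 := congrFun hx i
        rw [this, op_zero, zero_smul]
      · ext c
        constructor
        · rintro ⟨x, rfl⟩
          funext i
          change ∑ j, inner (e i) (e j) * inner (e j) x = inner (e i) x
          conv_rhs => rw [← he x, map_sum]
          refine Finset.sum_congr rfl fun j _ => ?_
          rw [map_smul, op_smul_eq_mul]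
        · intro hc
          refine ⟨∑ j, op (c j) • e j, ?_⟩
          rw [Set.mem_ofPred_eq] at hc
          conv_rhs => rw [← hc]
          funext i
          change inner (e i) (∑ j, op (c j) • e j) = ∑ j, inner (e i) (e j) * c j
          rw [map_sum]
          refine Finset.sum_congr rfl fun j _ => ?_
          rw [map_smul, op_smul_eq_mul]
      · let _ : TopologicalSpace A := LCPreCStarAlgebra.lcTop
        let _ : TopologicalSpace E := .induced (fun x i => inner (e i) x) inferInstance
        exact Topology.IsInducing.induced fun x i => inner (e i) x
    inner_smul := inner_smul
    norm_smul := by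
      choose C hC using hbound
      refine ⟨∑ i, (∑ j, C (e i) (e j)) ^ 2, fun b x => ?_⟩
      have hx : ∀ j, ‖inner (e j) x‖ ≤ √‖inner x x‖ := fun j => by
        refine Real.le_sqrt_of_sq_le ?_
        have := sq_norm_le_norm_sum_star_mul_self (fun i => inner (e i) x) j
        rwa [← hsum] at this
      have hbx : ∀ i, ‖inner (e i) (b • x)‖ ≤ (∑ j, C (e i) (e j)) * (‖b‖ * √‖inner x x‖) :=
        fun i => by
          rw [hcoord, Finset.sum_mul]
          refine norm_sum_le_of_le _ fun j _ => (norm_mul_le _ _).trans ?_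
          rw [← mul_assoc]
          exact mul_le_mul (hC _ _ _) (hx j) (norm_nonneg _)
            ((norm_nonneg _).trans (hC _ _ _))
      rw [hsum (b • x), mul_assoc, Finset.sum_mul]
      refine norm_sum_le_of_le _ fun i _ => (norm_mul_le _ _).trans ?_
      rw [norm_star, ← pow_two]
      refine (pow_le_pow_left₀ (norm_nonneg _) (hbx i) 2).trans_eq ?_
      rw [mul_pow, mul_pow, Real.sq_sqrt (norm_nonneg _)]
    jointly_continuous := by
      let _ : TopologicalSpace A := LCPreCStarAlgebra.lcTop
      let _ : TopologicalSpace B := LCPreCStarAlgebra.lcTop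
      have : IsTopologicalRing A := LCPreCStarAlgebra.lcTop_ring
      let φ : E → Fin n → A := fun x i => inner (e i) x
      let _ : TopologicalSpace E := TopologicalSpace.induced φ inferInstance
      have hφ : Continuous φ := continuous_induced_dom
      refine continuous_induced_rng.2 (continuous_pi fun i => ?_)
      have hfun : (fun q : B × E => inner (e i) (q.1 • q.2))
          = fun q => ∑ j, inner (e i) (q.1 • e j) * φ q.2 j := funext fun q => hcoord q.1 q.2 i
      change Continuous fun q : B × E => inner (e i) (q.1 • q.2)
      rw [hfun]
      exact continuous_finsetSum _ fun j _ => ((hcont (e i) (e j)).comp continuous_fst).mul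
        ((continuous_apply j).comp (hφ.comp continuous_snd)) }

/-- Transport of a finite Kasparov module along an isomorphism of bimodules. -/
def transport {F : AlgBimodule B A} (K : FiniteKasparov F) (θ : E ≃+ F)
    (hleft : ∀ (b : B) x, θ (b • x) = b • θ x)
    (hright : ∀ (a : A) x, θ (op a • x) = op a • θ x) : FiniteKasparov E :=
  let Θ : E →ₗ[Aᵐᵒᵖ] F :=
    { toFun := θ, map_add' := map_add θ, map_smul' := fun a x => hright (unop a) x }
  { inner := fun x => K.inner (θ x) ∘ₗ Θ
    inner_star := fun x y => K.inner_star _ _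
    inner_self_pos := fun x => K.inner_self_pos _
    inner_self_eq_zero := fun x hx => (map_eq_zero_iff θ θ.injective).1 (K.inner_self_eq_zero _ hx)
    top := K.top.induced θ
    finite_projective := by
      obtain ⟨n, p, φ, hp, hinj, hrange, hφ, hind⟩ := K.finite_projective
      refine ⟨n, p, φ ∘ₗ Θ, hp, hinj.comp θ.injective, ?_, fun x y => hφ _ _, ?_⟩
      · rw [← hrange]
        exact θ.surjective.range_comp φ
      · let _ : TopologicalSpace A := LCPreCStarAlgebra.lcTop
        let _ : TopologicalSpace F := K.top
        let _ : TopologicalSpace E := K.top.induced θ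
        exact hind.comp (Topology.IsInducing.induced θ)
    inner_smul := fun b x y => by
      change K.inner (θ (b • x)) (θ y) = K.inner (θ x) (θ (star b • y))
      rw [hleft, hleft, K.inner_smul]
    norm_smul := by
      obtain ⟨C, hC⟩ := K.norm_smul
      refine ⟨C, fun b x => ?_⟩
      change ‖K.inner (θ (b • x)) (θ (b • x))‖ ≤ C * ‖b‖ ^ 2 * ‖K.inner (θ x) (θ x)‖
      rw [hleft]
      exact hC b (θ x)
    jointly_continuous := by
      let _ : TopologicalSpace B := LCPreCStarAlgebra.lcTop
      let _ : TopologicalSpace F := K.top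
      let _ : TopologicalSpace E := K.top.induced θ
      have hθ : Continuous θ := continuous_induced_dom
      refine continuous_induced_rng.2 ?_
      change Continuous fun q : B × E => θ (q.1 • q.2)
      simp only [hleft]
      exact K.jointly_continuous.comp (continuous_fst.prodMk (hθ.comp continuous_snd)) }

theorem transport_inner {F : AlgBimodule B A} (K : FiniteKasparov F) (θ : E ≃+ F)
    (hleft : ∀ (b : B) x, θ (b • x) = b • θ x)
    (hright : ∀ (a : A) x, θ (op a • x) = op a • θ x) (x y : E) :
    (K.transport θ hleft hright).inner x y = K.inner (θ x) (θ y) := rfl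

end FiniteKasparov

end Frames

/-! ### The identity bimodule and the conjugate equivalence bimodule -/

section Conjugate

variable {B A : Type u} [LCPreCStarAlgebra B] [LCPreCStarAlgebra A] {E : AlgBimodule B A}

theorem AlgBimodule.toConj_op_smul (E : AlgBimodule B A) (a : A) (x : E) :
    E.toConj (op a • x) = star a • E.toConj x := by
  change _ = E.toConj (op (star (star a)) • x)
  rw [star_star]

theorem AlgBimodule.toConj_smul (E : AlgBimodule B A) (b : B) (x : E) :
    E.toConj (b • x) = op (star b) • E.toConj x := by
  change _ = E.toConj (star (star b) • x)
  rw [star_star]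

theorem AlgBimodule.toConj_complex_smul (E : AlgBimodule B A) (c : ℂ) (x : E) :
    E.toConj (c • x) = star c • E.toConj x := by
  change _ = E.toConj (star (star c) • x)
  rw [star_star]

/-- The conjugate of an equivalence bimodule; the inner products change places. -/
def EquivalenceBimodule.conj (K : EquivalenceBimodule E) : EquivalenceBimodule E.conj where
  right := K.left
  left := K.right.transport (E := E.conj.conj) (E.toConj.trans E.conj.toConj).symm
    (fun b f => by
      obtain ⟨x, rfl⟩ := (E.toConj.trans E.conj.toConj).surjective f
      rw [AddEquiv.symm_apply_apply, AddEquiv.symm_apply_eq]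
      change b • E.conj.toConj (E.toConj x) = E.conj.toConj (E.toConj (b • x))
      rw [E.toConj_smul, E.conj.toConj_op_smul, star_star])
    (fun a f => by
      obtain ⟨x, rfl⟩ := (E.toConj.trans E.conj.toConj).surjective f
      rw [AddEquiv.symm_apply_apply, AddEquiv.symm_apply_eq]
      change op a • E.conj.toConj (E.toConj x) = E.conj.toConj (E.toConj (op a • x))
      rw [E.toConj_op_smul, E.conj.toConj_smul, star_star])
  assoc f g k := by
    obtain ⟨x, rfl⟩ := E.toConj.surjective f
    obtain ⟨y, rfl⟩ := E.toConj.surjective g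
    obtain ⟨z, rfl⟩ := E.toConj.surjective k
    change K.right.inner x y • E.toConj z
      = op (K.left.inner (E.toConj y) (E.toConj z)) • E.toConj x
    rw [K.left.inner_star, ← E.toConj_smul, K.assoc, E.toConj_op_smul, ← K.right.inner_star]
  full_right := K.full_left
  full_left := K.full_right

end Conjugate

section Identity

variable (A : Type u) [LCPreCStarAlgebra A]

/-- The algebra `A` as an `A`-`A`-bimodule. -/
noncomputable abbrev AlgBimodule.self : AlgBimodule A A where
  carrier := A

/-- The functional `y ↦ x* y`. -/
def starMulLinear (x : A) : A →ₗ[Aᵐᵒᵖ] A where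
  toFun y := star x * y
  map_add' := mul_add _
  map_smul' a y := (mul_assoc _ y (unop a)).symm

/-- The inner product `(x, y) = x* y`; the element `1` is a frame. -/
noncomputable def FiniteKasparov.self : FiniteKasparov (AlgBimodule.self A) :=
  FiniteKasparov.ofFrame (E := AlgBimodule.self A) (starMulLinear A)
    (fun (x y : A) => by
      change star x * y = star (star y * x)
      rw [star_mul, star_star])
    (fun (b x y : A) => by
      change star (b * x) * y = star x * (star b * y)
      rw [star_mul, mul_assoc])
    (n := 1) (fun _ => (1 : A))
    (fun (x : A) => by
      change ∑ i : Fin 1, (1 : A) * (star (1 : A) * x) = x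
      simp)
    (fun (x y : A) => ⟨‖star x‖ * ‖y‖, fun (b : A) => by
      change ‖star x * (b * y)‖ ≤ _
      refine (norm_mul_le _ _).trans ?_
      rw [mul_assoc, mul_comm ‖y‖]
      exact mul_le_mul_of_nonneg_left (norm_mul_le _ _) (norm_nonneg _)⟩)
    (fun (x y : A) => by
      let _ : TopologicalSpace A := LCPreCStarAlgebra.lcTop
      have : IsTopologicalRing A := LCPreCStarAlgebra.lcTop_ring
      change Continuous fun b : A => star x * (b * y)
      fun_prop)

/-- The identity equivalence bimodule, with `(x, y) = x* y` and `⟨x, y⟩ = x y*`. -/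
noncomputable def EquivalenceBimodule.self : EquivalenceBimodule (AlgBimodule.self A) where
  right := FiniteKasparov.self A
  left := (FiniteKasparov.self A).transport (E := (AlgBimodule.self A).conj)
    ((AlgBimodule.self A).toConj.symm.trans (starAddEquiv : A ≃+ A))
    (fun b f => by
      obtain ⟨x, rfl⟩ := (AlgBimodule.self A).toConj.surjective f
      change star (x * star b : A) = b * star (x : A)
      rw [star_mul, star_star])
    (fun a f => by
      obtain ⟨x, rfl⟩ := (AlgBimodule.self A).toConj.surjective f
      change star (star a * x : A) = star (x : A) * a
      rw [star_mul, star_star])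
  assoc := fun (x y z : A) => by
    change (star (star x) * star y) * z = x * (star y * z)
    rw [star_star, mul_assoc]
  full_right := by
    refine Submodule.eq_top_iff'.2 fun a => Submodule.subset_span ⟨(1 : A), a, ?_⟩
    change a = star (1 : A) * a
    simp
  full_left := by
    refine Submodule.eq_top_iff'.2 fun a => Submodule.subset_span
      ⟨(AlgBimodule.self A).toConj (1 : A), (AlgBimodule.self A).toConj (star a), ?_⟩
    change a = star (star (1 : A)) * star (star a)
    simp

end Identity

/-! ### Tensor products of bimodules -/

section TensorBimodule

variable {C B A : Type u} [LCPreCStarAlgebra C] [LCPreCStarAlgebra B] [LCPreCStarAlgebra A]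

/-- The left action of `B` on a `B`-`A`-bimodule. -/
noncomputable def AlgBimodule.leftAction (E : AlgBimodule B A) : B →ₐ[ℂ] Module.End ℂ E :=
  Algebra.lsmul ℂ ℂ E

variable (F : AlgBimodule C B) (E : AlgBimodule B A)

/-- The map `x ⊗ y ↦ c x ⊗ y` on `F ⊗_B E`. -/
noncomputable def tensorLeftMul (c : C) :
    BalTensor F E.leftAction →ₗ[ℂ] BalTensor F E.leftAction :=
  BalTensor.lift E.leftAction (BalTensor.mk E.leftAction ∘ₗ F.leftAction c) fun x b y => by
    change BalTensor.tmul E.leftAction (c • op b • x) y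
      = BalTensor.tmul E.leftAction (c • x) (b • y)
    rw [smul_comm, BalTensor.smul_tmul]
    rfl

theorem tensorLeftMul_tmul (c : C) (x : F) (y : E) :
    tensorLeftMul F E c (BalTensor.tmul E.leftAction x y)
      = BalTensor.tmul E.leftAction (c • x) y := by
  rw [tensorLeftMul, BalTensor.lift_tmul]
  rfl

/-- The map `x ⊗ y ↦ x ⊗ y a` on `F ⊗_B E`. -/
noncomputable def tensorRightMul (a : Aᵐᵒᵖ) :
    BalTensor F E.leftAction →ₗ[ℂ] BalTensor F E.leftAction :=
  BalTensor.map (Algebra.lsmul ℂ ℂ E a) fun b y => by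
    change a • b • y = b • a • y
    exact (smul_comm b a y).symm

theorem tensorRightMul_tmul (a : Aᵐᵒᵖ) (x : F) (y : E) :
    tensorRightMul F E a (BalTensor.tmul E.leftAction x y)
      = BalTensor.tmul E.leftAction x (a • y) := by
  rw [tensorRightMul, BalTensor.map_tmul]
  rfl

/-- The action of `C` on the first factor of `F ⊗_B E`. -/
noncomputable def tensorLeftAction : C →ₐ[ℂ] Module.End ℂ (BalTensor F E.leftAction) :=
  AlgHom.ofLinearMap
    { toFun := tensorLeftMul F E
      map_add' := fun c d => LinearMap.ext <| BalTensor.linearMap_ext _ fun x y => by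
        rw [LinearMap.add_apply, tensorLeftMul_tmul, tensorLeftMul_tmul, tensorLeftMul_tmul,
          add_smul, BalTensor.add_tmul]
      map_smul' := fun z c => LinearMap.ext <| BalTensor.linearMap_ext _ fun x y => by
        rw [LinearMap.smul_apply, tensorLeftMul_tmul, tensorLeftMul_tmul, smul_assoc]
        exact congrArg (fun T : E →ₗ[ℂ] _ => T y) (map_smul (BalTensor.mk E.leftAction) z (c • x)) }
    (LinearMap.ext <| BalTensor.linearMap_ext _ fun x y => by
      change tensorLeftMul F E 1 (BalTensor.tmul E.leftAction x y) = _
      rw [tensorLeftMul_tmul, one_smul]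
      rfl)
    (fun c d => LinearMap.ext <| BalTensor.linearMap_ext _ fun x y => by
      change tensorLeftMul F E (c * d) (BalTensor.tmul E.leftAction x y)
        = tensorLeftMul F E c (tensorLeftMul F E d (BalTensor.tmul E.leftAction x y))
      rw [tensorLeftMul_tmul, tensorLeftMul_tmul, tensorLeftMul_tmul, mul_smul])

/-- The action of `A` on the second factor of `F ⊗_B E`. -/
noncomputable def tensorRightAction : Aᵐᵒᵖ →ₐ[ℂ] Module.End ℂ (BalTensor F E.leftAction) :=
  AlgHom.ofLinearMap
    { toFun := tensorRightMul F E
      map_add' := fun a b => LinearMap.ext <| BalTensor.linearMap_ext _ fun x y => by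
        rw [LinearMap.add_apply, tensorRightMul_tmul, tensorRightMul_tmul, tensorRightMul_tmul,
          add_smul, BalTensor.tmul_add]
      map_smul' := fun z a => LinearMap.ext <| BalTensor.linearMap_ext _ fun x y => by
        rw [LinearMap.smul_apply, tensorRightMul_tmul, tensorRightMul_tmul, smul_assoc,
          BalTensor.tmul_smul]
        rfl }
    (LinearMap.ext <| BalTensor.linearMap_ext _ fun x y => by
      change tensorRightMul F E 1 (BalTensor.tmul E.leftAction x y) = _
      rw [tensorRightMul_tmul, one_smul]
      rfl)
    (fun a b => LinearMap.ext <| BalTensor.linearMap_ext _ fun x y => by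
      change tensorRightMul F E (a * b) (BalTensor.tmul E.leftAction x y)
        = tensorRightMul F E a (tensorRightMul F E b (BalTensor.tmul E.leftAction x y))
      rw [tensorRightMul_tmul, tensorRightMul_tmul, tensorRightMul_tmul, mul_smul])

/-- The `C`-`A`-bimodule `F ⊗_B E`. -/
noncomputable def AlgBimodule.tensor : AlgBimodule C A :=
  letI : Module C (BalTensor F E.leftAction) := Module.compHom _ (tensorLeftAction F E).toRingHom
  letI : Module Aᵐᵒᵖ (BalTensor F E.leftAction) :=
    Module.compHom _ (tensorRightAction F E).toRingHom
  { carrier := BalTensor F E.leftAction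
    towerLeft := ⟨fun z c t => by
      change tensorLeftAction F E (z • c) t = z • tensorLeftAction F E c t
      rw [map_smul]
      rfl⟩
    towerRight := ⟨fun z a t => by
      change tensorRightAction F E (z • a) t = z • tensorRightAction F E a t
      rw [map_smul]
      rfl⟩
    smulComm := ⟨fun c a t => by
      change tensorLeftAction F E c (tensorRightAction F E a t)
        = tensorRightAction F E a (tensorLeftAction F E c t)
      refine BalTensor.linearMap_ext _ (f := tensorLeftMul F E c ∘ₗ tensorRightMul F E a)
        (g := tensorRightMul F E a ∘ₗ tensorLeftMul F E c) (fun x y => ?_) t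
      simp only [LinearMap.comp_apply, tensorLeftMul_tmul, tensorRightMul_tmul]⟩ }

namespace AlgBimodule

variable {F E}

/-- The elementary tensor `x ⊗ y` in `F ⊗_B E`. -/
noncomputable def tmul (x : F) (y : E) : F.tensor E := BalTensor.tmul E.leftAction x y

theorem add_tmul (x x' : F) (y : E) : tmul (x + x') y = tmul x y + tmul x' y :=
  BalTensor.add_tmul ..

theorem tmul_add (x : F) (y y' : E) : tmul x (y + y') = tmul x y + tmul x y' :=
  BalTensor.tmul_add ..

theorem complex_smul_tmul (c : ℂ) (x : F) (y : E) : tmul (c • x) y = c • tmul x y :=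
  congrArg (fun T : E →ₗ[ℂ] _ => T y) (map_smul (BalTensor.mk E.leftAction) c x)

theorem tmul_complex_smul (c : ℂ) (x : F) (y : E) : tmul x (c • y) = c • tmul x y :=
  BalTensor.tmul_smul ..

theorem op_smul_tmul_eq (x : F) (b : B) (y : E) : tmul (op b • x) y = tmul x (b • y) :=
  BalTensor.smul_tmul ..

theorem smul_tmul (c : C) (x : F) (y : E) : c • tmul x y = tmul (c • x) y :=
  tensorLeftMul_tmul ..

theorem op_smul_tmul (a : A) (x : F) (y : E) : op a • tmul x y = tmul x (op a • y) :=
  tensorRightMul_tmul ..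

theorem tensor_induction {P : F.tensor E → Prop} (t : F.tensor E) (tmul : ∀ x y, P (tmul x y))
    (add : ∀ s t, P s → P t → P (s + t)) : P t :=
  BalTensor.induction_on E.leftAction t tmul add

/-- The linear map on `F ⊗_B E` induced by a balanced bilinear map. -/
noncomputable def tensorLift {N : Type w} [AddCommGroup N] [Module ℂ N] (f : F →ₗ[ℂ] E →ₗ[ℂ] N)
    (hf : ∀ x (b : B) y, f (op b • x) y = f x (b • y)) : F.tensor E →ₗ[ℂ] N :=
  BalTensor.lift E.leftAction f hf

theorem tensorLift_tmul {N : Type w} [AddCommGroup N] [Module ℂ N] (f : F →ₗ[ℂ] E →ₗ[ℂ] N)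
    (hf : ∀ x (b : B) y, f (op b • x) y = f x (b • y)) (x : F) (y : E) :
    tensorLift f hf (tmul x y) = f x y :=
  BalTensor.lift_tmul ..

theorem tmul_sum {ι : Type*} (s : Finset ι) (x : F) (y : ι → E) :
    tmul x (∑ i ∈ s, y i) = ∑ i ∈ s, tmul x (y i) :=
  map_sum (BalTensor.mk E.leftAction x) y s

theorem sum_tmul {ι : Type*} (s : Finset ι) (x : ι → F) (y : E) :
    tmul (∑ i ∈ s, x i) y = ∑ i ∈ s, tmul (x i) y :=
  BalTensor.sum_tmul ..

/-- The antilinear map `x ⊗ y ↦ f_y ⊗ f_x`, as a linear map to a conjugate space. -/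
noncomputable def tensorSwap (F : AlgBimodule C B) (E : AlgBimodule B A) :
    F.tensor E →ₗ[ℂ] (E.conj.tensor F.conj).conj :=
  tensorLift
    (LinearMap.mk₂ ℂ
      (fun x y => (E.conj.tensor F.conj).toConj (tmul (E.toConj y) (F.toConj x)))
      (fun x x' y => by rw [map_add, tmul_add, map_add])
      (fun c x y => by
        rw [toConj_complex_smul, tmul_complex_smul, toConj_complex_smul, star_star])
      (fun x y y' => by rw [map_add, add_tmul, map_add])
      (fun c x y => by
        rw [toConj_complex_smul, complex_smul_tmul, toConj_complex_smul, star_star]))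
    fun x b y => by
      simp only [LinearMap.mk₂_apply]
      rw [toConj_op_smul, toConj_smul, op_smul_tmul_eq]

theorem tensorSwap_tmul (x : F) (y : E) : tensorSwap F E (tmul x y)
    = (E.conj.tensor F.conj).toConj (tmul (E.toConj y) (F.toConj x)) := by
  rw [tensorSwap, tensorLift_tmul, LinearMap.mk₂_apply]

/-- The antilinear map `f_y ⊗ f_x ↦ x ⊗ y`, as a linear map to a conjugate space. -/
noncomputable def tensorUnswap (F : AlgBimodule C B) (E : AlgBimodule B A) :
    E.conj.tensor F.conj →ₗ[ℂ] (F.tensor E).conj :=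
  tensorLift
    (LinearMap.mk₂ ℂ
      (fun y x => (F.tensor E).toConj (tmul (F.toConj.symm x) (E.toConj.symm y)))
      (fun y y' x => by rw [map_add, tmul_add, map_add])
      (fun c y x => by
        obtain ⟨y, rfl⟩ := E.toConj.surjective y
        rw [← star_star c, ← toConj_complex_smul, AddEquiv.symm_apply_apply,
          AddEquiv.symm_apply_apply, tmul_complex_smul, toConj_complex_smul])
      (fun y x x' => by rw [map_add, add_tmul, map_add])
      (fun c y x => by
        obtain ⟨x, rfl⟩ := F.toConj.surjective x
        rw [← star_star c, ← toConj_complex_smul, AddEquiv.symm_apply_apply,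
          AddEquiv.symm_apply_apply, complex_smul_tmul, toConj_complex_smul]))
    fun y b x => by
      obtain ⟨x, rfl⟩ := F.toConj.surjective x
      obtain ⟨y, rfl⟩ := E.toConj.surjective y
      simp only [LinearMap.mk₂_apply]
      rw [← star_star b, ← toConj_op_smul, ← toConj_smul, AddEquiv.symm_apply_apply,
        AddEquiv.symm_apply_apply, AddEquiv.symm_apply_apply, AddEquiv.symm_apply_apply,
        op_smul_tmul_eq]

theorem tensorUnswap_tmul (x : F) (y : E) : tensorUnswap F E (tmul (E.toConj y) (F.toConj x))
    = (F.tensor E).toConj (tmul x y) := by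
  rw [tensorUnswap, tensorLift_tmul, LinearMap.mk₂_apply, AddEquiv.symm_apply_apply,
    AddEquiv.symm_apply_apply]

theorem tensorUnswap_tensorSwap (t : F.tensor E) :
    tensorUnswap F E ((E.conj.tensor F.conj).toConj.symm (tensorSwap F E t))
      = (F.tensor E).toConj t := by
  induction t using tensor_induction with
  | tmul x y => rw [tensorSwap_tmul, AddEquiv.symm_apply_apply, tensorUnswap_tmul]
  | add s t hs ht => rw [map_add, map_add, map_add, hs, ht, map_add]

theorem tensorSwap_tensorUnswap (t : E.conj.tensor F.conj) :
    tensorSwap F E ((F.tensor E).toConj.symm (tensorUnswap F E t))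
      = (E.conj.tensor F.conj).toConj t := by
  induction t using tensor_induction with
  | tmul y x =>
    obtain ⟨x, rfl⟩ := F.toConj.surjective x
    obtain ⟨y, rfl⟩ := E.toConj.surjective y
    rw [tensorUnswap_tmul, AddEquiv.symm_apply_apply, tensorSwap_tmul]
  | add s t hs ht => rw [map_add, map_add, map_add, hs, ht, map_add]

/-- The conjugate of a tensor product: `f_{x ⊗ y}` corresponds to `f_y ⊗ f_x`. -/
noncomputable def tensorConj (F : AlgBimodule C B) (E : AlgBimodule B A) :
    (F.tensor E).conj ≃+ E.conj.tensor F.conj where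
  toFun t := (E.conj.tensor F.conj).toConj.symm (tensorSwap F E ((F.tensor E).toConj.symm t))
  invFun := tensorUnswap F E
  left_inv t := by rw [tensorUnswap_tensorSwap, AddEquiv.apply_symm_apply]
  right_inv t := by
    change (E.conj.tensor F.conj).toConj.symm
      (tensorSwap F E ((F.tensor E).toConj.symm (tensorUnswap F E t))) = t
    rw [tensorSwap_tensorUnswap, AddEquiv.symm_apply_apply]
  map_add' s t := by rw [map_add, map_add, map_add]

theorem tensorConj_toConj_tmul (x : F) (y : E) :
    tensorConj F E ((F.tensor E).toConj (tmul x y)) = tmul (E.toConj y) (F.toConj x) := by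
  change (E.conj.tensor F.conj).toConj.symm (tensorSwap F E
    ((F.tensor E).toConj.symm ((F.tensor E).toConj (tmul x y)))) = _
  rw [AddEquiv.symm_apply_apply, tensorSwap_tmul, AddEquiv.symm_apply_apply]

theorem tensorConj_smul (a : A) (t : (F.tensor E).conj) :
    tensorConj F E (a • t) = a • tensorConj F E t := by
  obtain ⟨t, rfl⟩ := (F.tensor E).toConj.surjective t
  induction t using tensor_induction with
  | tmul x y =>
    rw [← star_star a, ← toConj_op_smul, op_smul_tmul, tensorConj_toConj_tmul,
      tensorConj_toConj_tmul, toConj_op_smul, smul_tmul]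
  | add s t hs ht => rw [map_add, smul_add, map_add, hs, ht, map_add, smul_add]

theorem tensorConj_op_smul (c : C) (t : (F.tensor E).conj) :
    tensorConj F E (op c • t) = op c • tensorConj F E t := by
  obtain ⟨t, rfl⟩ := (F.tensor E).toConj.surjective t
  induction t using tensor_induction with
  | tmul x y =>
    rw [← star_star c, ← toConj_smul, smul_tmul, tensorConj_toConj_tmul,
      tensorConj_toConj_tmul, toConj_smul, op_smul_tmul]
  | add s t hs ht => rw [map_add, smul_add, map_add, hs, ht, map_add, smul_add]

end AlgBimodule

end TensorBimodule

/-! ### Tensor products of equivalence bimodules -/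

section TensorKasparov

open AlgBimodule

variable {C B A : Type u} [LCPreCStarAlgebra C] [LCPreCStarAlgebra B] [LCPreCStarAlgebra A]
  {F : AlgBimodule C B} {E : AlgBimodule B A}

namespace FiniteKasparov

theorem inner_complex_smul_right (K : FiniteKasparov E) (c : ℂ) (x y : E) :
    K.inner x (c • y) = c • K.inner x y :=
  LinearMap.map_smul_of_tower _ c y

theorem inner_op_smul_right (K : FiniteKasparov E) (a : A) (x y : E) :
    K.inner x (op a • y) = K.inner x y * a :=
  map_smul (K.inner x) (op a) y

theorem inner_complex_smul_left (K : FiniteKasparov E) (c : ℂ) (x y : E) :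
    K.inner (c • x) y = star c • K.inner x y := by
  rw [K.inner_star, inner_complex_smul_right, star_smul, ← K.inner_star]

variable (K₂ : FiniteKasparov F) (K₁ : FiniteKasparov E)

/-- The functional `x₂ ⊗ x₁ ↦ (y₁, (y₂, x₂) x₁)`. -/
noncomputable def tensorFunctional (y₂ : F) (y₁ : E) : F.tensor E →ₗ[ℂ] A :=
  tensorLift
    (LinearMap.mk₂ ℂ (fun x₂ x₁ => K₁.inner y₁ (K₂.inner y₂ x₂ • x₁))
      (fun x x' y => by rw [map_add, add_smul, map_add])
      (fun c x y => by
        rw [inner_complex_smul_right, smul_assoc, inner_complex_smul_right])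
      (fun x y y' => by rw [smul_add, map_add])
      (fun c x y => by rw [smul_comm, inner_complex_smul_right]))
    fun x b y => by
      simp only [LinearMap.mk₂_apply]
      rw [inner_op_smul_right, mul_smul]

theorem tensorFunctional_tmul (y₂ x₂ : F) (y₁ x₁ : E) :
    tensorFunctional K₂ K₁ y₂ y₁ (tmul x₂ x₁) = K₁.inner y₁ (K₂.inner y₂ x₂ • x₁) :=
  tensorLift_tmul ..

theorem tensorFunctional_add_left (y₂ y₂' : F) (y₁ : E) (x : F.tensor E) :
    tensorFunctional K₂ K₁ (y₂ + y₂') y₁ x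
      = tensorFunctional K₂ K₁ y₂ y₁ x + tensorFunctional K₂ K₁ y₂' y₁ x := by
  induction x using tensor_induction with
  | tmul x₂ x₁ =>
    simp only [tensorFunctional_tmul, K₂.inner_add_left, add_smul, map_add]
  | add s t hs ht => rw [map_add, map_add, map_add, hs, ht, add_add_add_comm]

theorem tensorFunctional_add_right (y₂ : F) (y₁ y₁' : E) (x : F.tensor E) :
    tensorFunctional K₂ K₁ y₂ (y₁ + y₁') x
      = tensorFunctional K₂ K₁ y₂ y₁ x + tensorFunctional K₂ K₁ y₂ y₁' x := by
  induction x using tensor_induction with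
  | tmul x₂ x₁ => simp only [tensorFunctional_tmul, K₁.inner_add_left]
  | add s t hs ht => rw [map_add, map_add, map_add, hs, ht, add_add_add_comm]

theorem tensorFunctional_smul_left (c : ℂ) (y₂ : F) (y₁ : E) (x : F.tensor E) :
    tensorFunctional K₂ K₁ (c • y₂) y₁ x = star c • tensorFunctional K₂ K₁ y₂ y₁ x := by
  induction x using tensor_induction with
  | tmul x₂ x₁ =>
    rw [tensorFunctional_tmul, tensorFunctional_tmul, K₂.inner_complex_smul_left, smul_assoc,
      inner_complex_smul_right]
  | add s t hs ht => rw [map_add, map_add, hs, ht, smul_add]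

theorem tensorFunctional_smul_right (c : ℂ) (y₂ : F) (y₁ : E) (x : F.tensor E) :
    tensorFunctional K₂ K₁ y₂ (c • y₁) x = star c • tensorFunctional K₂ K₁ y₂ y₁ x := by
  induction x using tensor_induction with
  | tmul x₂ x₁ =>
    rw [tensorFunctional_tmul, tensorFunctional_tmul, K₁.inner_complex_smul_left]
  | add s t hs ht => rw [map_add, map_add, hs, ht, smul_add]

theorem tensorFunctional_balanced (y₂ : F) (b : B) (y₁ : E) (x : F.tensor E) :
    tensorFunctional K₂ K₁ (op b • y₂) y₁ x = tensorFunctional K₂ K₁ y₂ (b • y₁) x := by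
  induction x using tensor_induction with
  | tmul x₂ x₁ =>
    rw [tensorFunctional_tmul, tensorFunctional_tmul, K₂.inner_op_smul_left, mul_smul,
      K₁.inner_smul]
  | add s t hs ht => rw [map_add, map_add, hs, ht]

/-- The inner product of `F ⊗_B E`, as a function of its second argument. -/
noncomputable def tensorInner (x : F.tensor E) : F.tensor E →ₗ[ℂ] A :=
  tensorLift
    (LinearMap.mk₂ ℂ (fun y₂ y₁ => star (tensorFunctional K₂ K₁ y₂ y₁ x))
      (fun y y' z => by rw [tensorFunctional_add_left, star_add])
      (fun c y z => by rw [tensorFunctional_smul_left, star_smul, star_star])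
      (fun y z z' => by rw [tensorFunctional_add_right, star_add])
      (fun c y z => by rw [tensorFunctional_smul_right, star_smul, star_star]))
    fun y b z => by
      simp only [LinearMap.mk₂_apply]
      rw [tensorFunctional_balanced]

theorem tensorInner_tmul_right (x : F.tensor E) (y₂ : F) (y₁ : E) :
    tensorInner K₂ K₁ x (tmul y₂ y₁) = star (tensorFunctional K₂ K₁ y₂ y₁ x) :=
  tensorLift_tmul ..

theorem tensorInner_tmul_tmul (x₂ y₂ : F) (x₁ y₁ : E) :
    tensorInner K₂ K₁ (tmul x₂ x₁) (tmul y₂ y₁) = K₁.inner x₁ (K₂.inner x₂ y₂ • y₁) := by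
  rw [tensorInner_tmul_right, tensorFunctional_tmul, ← K₁.inner_star, K₁.inner_smul,
    ← K₂.inner_star]

theorem tensorInner_add_left (x x' y : F.tensor E) :
    tensorInner K₂ K₁ (x + x') y = tensorInner K₂ K₁ x y + tensorInner K₂ K₁ x' y := by
  induction y using tensor_induction with
  | tmul y₂ y₁ => simp only [tensorInner_tmul_right, map_add, star_add]
  | add s t hs ht => rw [map_add, map_add, map_add, hs, ht, add_add_add_comm]

theorem tensorInner_star (x y : F.tensor E) :
    tensorInner K₂ K₁ x y = star (tensorInner K₂ K₁ y x) := by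
  induction x using tensor_induction with
  | tmul x₂ x₁ =>
    induction y using tensor_induction with
    | tmul y₂ y₁ =>
      rw [tensorInner_tmul_tmul, tensorInner_tmul_right, star_star, tensorFunctional_tmul]
    | add s t hs ht => rw [map_add, tensorInner_add_left, star_add, hs, ht]
  | add s t hs ht => rw [map_add, tensorInner_add_left, star_add, hs, ht]

theorem tensorInner_op_smul (a : A) (x y : F.tensor E) :
    tensorInner K₂ K₁ x (op a • y) = tensorInner K₂ K₁ x y * a := by
  induction x using tensor_induction with
  | tmul x₂ x₁ =>
    induction y using tensor_induction with
    | tmul y₂ y₁ =>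
      rw [op_smul_tmul, tensorInner_tmul_tmul, tensorInner_tmul_tmul, smul_comm, map_smul,
        op_smul_eq_mul]
    | add s t hs ht => rw [smul_add, map_add, map_add, hs, ht, add_mul]
  | add s t hs ht => rw [tensorInner_add_left, tensorInner_add_left, hs, ht, add_mul]

theorem tensorInner_smul (c : C) (x y : F.tensor E) :
    tensorInner K₂ K₁ (c • x) y = tensorInner K₂ K₁ x (star c • y) := by
  induction x using tensor_induction with
  | tmul x₂ x₁ =>
    induction y using tensor_induction with
    | tmul y₂ y₁ =>
      rw [smul_tmul, smul_tmul, tensorInner_tmul_tmul, tensorInner_tmul_tmul, K₂.inner_smul]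
    | add s t hs ht => rw [smul_add, map_add, map_add, hs, ht]
  | add s t hs ht => rw [smul_add, tensorInner_add_left, tensorInner_add_left, hs, ht]

/-- The interior tensor product of finite Kasparov modules, with
`(x₂ ⊗ x₁, y₂ ⊗ y₁) = (x₁, (x₂, y₂) y₁)`; the tensor products of the vectors of two frames form a
frame. -/
noncomputable def tensor : FiniteKasparov (F.tensor E) :=
  ofFrame
    (fun x => { toFun := tensorInner K₂ K₁ x
                map_add' := map_add _
                map_smul' := fun a y => tensorInner_op_smul K₂ K₁ (unop a) x y })
    (tensorInner_star K₂ K₁) (tensorInner_smul K₂ K₁)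
    (n := K₂.exists_frame.choose * K₁.exists_frame.choose)
    (fun k => tmul (K₂.exists_frame.choose_spec.choose (finProdFinEquiv.symm k).1)
      (K₁.exists_frame.choose_spec.choose (finProdFinEquiv.symm k).2))
    (fun x => by
      set e₂ := K₂.exists_frame.choose_spec.choose
      set e₁ := K₁.exists_frame.choose_spec.choose
      have h₂ : ∀ x, ∑ i, op (K₂.inner (e₂ i) x) • e₂ i = x :=
        K₂.exists_frame.choose_spec.choose_spec
      have h₁ : ∀ x, ∑ i, op (K₁.inner (e₁ i) x) • e₁ i = x :=
        K₁.exists_frame.choose_spec.choose_spec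
      change ∑ k, op (tensorInner K₂ K₁ (tmul (e₂ (finProdFinEquiv.symm k).1)
        (e₁ (finProdFinEquiv.symm k).2)) x) • tmul (e₂ (finProdFinEquiv.symm k).1)
        (e₁ (finProdFinEquiv.symm k).2) = x
      rw [finProdFinEquiv.symm.sum_comp
        (fun k => op (tensorInner K₂ K₁ (tmul (e₂ k.1) (e₁ k.2)) x) • tmul (e₂ k.1) (e₁ k.2)),
        Fintype.sum_prod_type]
      induction x using tensor_induction with
      | tmul x₂ x₁ =>
        simp only [tensorInner_tmul_tmul, op_smul_tmul, ← tmul_sum, h₁]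
        simp only [← op_smul_tmul_eq, ← sum_tmul, h₂]
      | add s t hs ht => simp only [map_add, op_add, add_smul, Finset.sum_add_distrib, hs, ht])
    (fun x y => by
      change ∃ M : ℝ, ∀ c : C, ‖tensorInner K₂ K₁ x (c • y)‖ ≤ M * ‖c‖
      have hadd : ∀ {f g : C → A}, (∃ M : ℝ, ∀ c, ‖f c‖ ≤ M * ‖c‖) →
          (∃ M : ℝ, ∀ c, ‖g c‖ ≤ M * ‖c‖) → ∃ M : ℝ, ∀ c, ‖f c + g c‖ ≤ M * ‖c‖ := by
        rintro f g ⟨M, hM⟩ ⟨N, hN⟩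
        refine ⟨M + N, fun c => (norm_add_le_of_le (hM c) (hN c)).trans_eq ?_⟩
        ring
      induction x using tensor_induction with
      | tmul x₂ x₁ =>
        induction y using tensor_induction with
        | tmul y₂ y₁ =>
          obtain ⟨M, hM⟩ := K₂.exists_norm_inner_smul_le x₂ y₂
          obtain ⟨N, hN⟩ := K₁.exists_norm_inner_smul_le x₁ y₁
          refine ⟨|N| * M, fun c => ?_⟩
          rw [smul_tmul, tensorInner_tmul_tmul, mul_assoc]
          refine (hN _).trans
            ((mul_le_mul_of_nonneg_right (le_abs_self N) (norm_nonneg _)).trans ?_)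
          exact mul_le_mul_of_nonneg_left (hM c) (abs_nonneg N)
        | add s t hs ht =>
          simp only [smul_add, map_add]
          exact hadd hs ht
      | add s t hs ht =>
        simp only [tensorInner_add_left]
        exact hadd hs ht)
    (fun x y => by
      let _ : TopologicalSpace A := LCPreCStarAlgebra.lcTop
      let _ : TopologicalSpace B := LCPreCStarAlgebra.lcTop
      let _ : TopologicalSpace C := LCPreCStarAlgebra.lcTop
      have : IsTopologicalRing A := LCPreCStarAlgebra.lcTop_ring
      change Continuous fun c : C => tensorInner K₂ K₁ x (c • y)
      induction x using tensor_induction with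
      | tmul x₂ x₁ =>
        induction y using tensor_induction with
        | tmul y₂ y₁ =>
          simp only [smul_tmul, tensorInner_tmul_tmul]
          exact (K₁.continuous_inner_smul x₁ y₁).comp (K₂.continuous_inner_smul x₂ y₂)
        | add s t hs ht =>
          simp only [smul_add, map_add]
          exact hs.add ht
      | add s t hs ht =>
        simp only [tensorInner_add_left]
        exact hs.add ht)

theorem tensor_inner_tmul_tmul (x₂ y₂ : F) (x₁ y₁ : E) :
    (tensor K₂ K₁).inner (tmul x₂ x₁) (tmul y₂ y₁) = K₁.inner x₁ (K₂.inner x₂ y₂ • y₁) :=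
  tensorInner_tmul_tmul ..

/-- Fullness of an inner product follows from a resolution of the unit. -/
theorem span_inner_eq_top (K : FiniteKasparov E) {ι : Type*} (s : Finset ι) (x y : ι → E)
    (h : ∑ i ∈ s, K.inner (x i) (y i) = 1) :
    Submodule.span ℂ {a : A | ∃ x y : E, a = K.inner x y} = ⊤ := by
  refine Submodule.eq_top_iff'.2 fun a => ?_
  rw [← one_mul a, ← h, Finset.sum_mul]
  refine Submodule.sum_mem _ fun i _ => Submodule.subset_span ⟨x i, op a • y i, ?_⟩
  rw [map_smul, op_smul_eq_mul]

theorem span_tensor_inner_eq_top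
    (h₂ : Submodule.span ℂ {b : B | ∃ x y : F, b = K₂.inner x y} = ⊤)
    (h₁ : Submodule.span ℂ {a : A | ∃ x y : E, a = K₁.inner x y} = ⊤) :
    Submodule.span ℂ {a : A | ∃ x y : F.tensor E, a = (tensor K₂ K₁).inner x y} = ⊤ := by
  obtain ⟨m, u₂, v₂, huv₂⟩ := K₂.exists_sum_inner_eq_one h₂
  obtain ⟨n, u₁, v₁, huv₁⟩ := K₁.exists_sum_inner_eq_one h₁
  refine span_inner_eq_top _ Finset.univ (fun k : Fin n × Fin m => tmul (u₂ k.2) (u₁ k.1))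
    (fun k => tmul (v₂ k.2) (v₁ k.1)) ?_
  rw [Fintype.sum_prod_type]
  simp only [tensor_inner_tmul_tmul, ← map_sum, ← Finset.sum_smul, huv₂, one_smul, huv₁]

end FiniteKasparov

/-- The tensor product of equivalence bimodules; its left inner product is
`⟨x₂ ⊗ x₁, y₂ ⊗ y₁⟩ = ⟨x₂ ⟨x₁, y₁⟩, y₂⟩`. -/
noncomputable def EquivalenceBimodule.tensor (K₂ : EquivalenceBimodule F)
    (K₁ : EquivalenceBimodule E) : EquivalenceBimodule (F.tensor E) where
  right := K₂.right.tensor K₁.right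
  left := (K₁.left.tensor K₂.left).transport (tensorConj F E) tensorConj_smul tensorConj_op_smul
  assoc x y z := by
    simp only [FiniteKasparov.transport_inner]
    induction x using tensor_induction with
    | tmul x₂ x₁ =>
      induction y using tensor_induction with
      | tmul y₂ y₁ =>
        induction z using tensor_induction with
        | tmul z₂ z₁ =>
          have h : ∀ b : B, b • F.toConj y₂ = F.toConj (op (star b) • y₂) := fun b => by
            rw [toConj_op_smul, star_star]
          rw [tensorConj_toConj_tmul, tensorConj_toConj_tmul,
            FiniteKasparov.tensor_inner_tmul_tmul, FiniteKasparov.tensor_inner_tmul_tmul,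
            smul_tmul, op_smul_tmul, ← K₁.assoc, h, K₂.assoc, FiniteKasparov.inner_op_smul_left,
            star_star, op_smul_tmul_eq, mul_smul]
        | add s t hs ht => rw [smul_add, hs, ht, map_add, op_add, add_smul]
      | add s t hs ht =>
        rw [map_add, map_add, map_add, add_smul, hs, ht, FiniteKasparov.inner_add_left, op_add,
          add_smul]
    | add s t hs ht =>
      rw [map_add, map_add, FiniteKasparov.inner_add_left, add_smul, hs, ht, smul_add]
  full_right := K₂.right.span_tensor_inner_eq_top _ K₂.full_right K₁.full_right
  full_left := by
    have h := K₁.left.span_tensor_inner_eq_top _ K₁.full_left K₂.full_left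
    rw [← h]
    congr 1
    ext c
    constructor
    · rintro ⟨x, y, rfl⟩
      exact ⟨_, _, rfl⟩
    · rintro ⟨x, y, rfl⟩
      refine ⟨(tensorConj F E).symm x, (tensorConj F E).symm y, ?_⟩
      rw [FiniteKasparov.transport_inner, AddEquiv.apply_symm_apply, AddEquiv.apply_symm_apply]

end TensorKasparov

/-! ### Identity, conjugate and composition of Dirac representations -/

section Equivalence

open ContinuousLinearMap (adjoint)

/-- An algebra with its representation on a spectral triple. -/
theorem UnitalSpectralTriple.isDiracRepresentation_self (σ : UnitalSpectralTriple.{u, v}) :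
    IsDiracRepresentation (σ := σ) (τ := σ) (EquivalenceBimodule.self σ.A)
      (σ.rep.toAlgHom.toLinearMap : σ.A →ₗ[ℂ] σ.H →L[ℂ] σ.H) where
  map_right := fun (x a : σ.A) => map_mul σ.rep x a
  map_left := fun (b x : σ.A) => map_mul σ.rep b x
  adjoint_comp := fun (x y : σ.A) => by
    change star (σ.rep x) * σ.rep y = σ.rep (star x * y)
    rw [map_mul, map_star]
  comp_adjoint := fun (x y : σ.A) => by
    change σ.rep x * star (σ.rep y) = σ.rep (star (star x) * star y)
    rw [star_star, map_mul, map_star]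
  exists_commutator := fun (x : σ.A) => ⟨_, σ.isCommutator_rep x⟩
  even_iff := Iff.rfl
  map_grading γ hγ γ' hγ' := fun (x : σ.A) => by
    obtain rfl := Option.mem_unique hγ hγ'
    exact (σ.grading_rep γ hγ x).symm

section Conjugate

variable {σ τ : UnitalSpectralTriple.{u, v}} {E : AlgBimodule τ.A σ.A}

/-- The map `f_x ↦ (L x)*` on the conjugate bimodule. -/
noncomputable def conjOperator (L : E →ₗ[ℂ] σ.H →L[ℂ] τ.H) : E.conj →ₗ[ℂ] τ.H →L[ℂ] σ.H where
  toFun f := adjoint (L (E.toConj.symm f))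
  map_add' f g := by rw [map_add, map_add, map_add]
  map_smul' c f := by
    obtain ⟨x, rfl⟩ := E.toConj.surjective f
    rw [← star_star c, ← E.toConj_complex_smul, AddEquiv.symm_apply_apply,
      AddEquiv.symm_apply_apply, map_smul, map_smulₛₗ]
    rfl

theorem conjOperator_toConj (L : E →ₗ[ℂ] σ.H →L[ℂ] τ.H) (x : E) :
    conjOperator L (E.toConj x) = adjoint (L x) := rfl

variable {K : EquivalenceBimodule E} {L : E →ₗ[ℂ] σ.H →L[ℂ] τ.H}

theorem IsDiracRepresentation.isCommutator_conj (hL : IsDiracRepresentation K L) (x : E) :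
    IsCommutator τ.D σ.D (conjOperator L (E.toConj x)) (-adjoint (hL.commutator x)) :=
  (hL.isCommutator x).adjoint σ.isSelfAdjoint τ.isSelfAdjoint

theorem IsDiracRepresentation.conj (hL : IsDiracRepresentation K L) :
    IsDiracRepresentation (σ := τ) (τ := σ) K.conj (conjOperator L) where
  map_right f b := by
    obtain ⟨x, rfl⟩ := E.toConj.surjective f
    rw [← star_star b, ← E.toConj_smul, conjOperator_toConj, conjOperator_toConj, hL.map_left,
      ContinuousLinearMap.adjoint_comp, ← ContinuousLinearMap.star_eq_adjoint (τ.rep _)]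
    simp only [map_star, star_star]
  map_left a f := by
    obtain ⟨x, rfl⟩ := E.toConj.surjective f
    rw [← star_star a, ← E.toConj_op_smul, conjOperator_toConj, conjOperator_toConj, hL.map_right,
      ContinuousLinearMap.adjoint_comp, ← ContinuousLinearMap.star_eq_adjoint (σ.rep _)]
    simp only [map_star, star_star]
  adjoint_comp f g := by
    obtain ⟨x, rfl⟩ := E.toConj.surjective f
    obtain ⟨y, rfl⟩ := E.toConj.surjective g
    rw [conjOperator_toConj, conjOperator_toConj, ContinuousLinearMap.adjoint_adjoint]
    exact hL.comp_adjoint x y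
  comp_adjoint f g := by
    obtain ⟨x, rfl⟩ := E.toConj.surjective f
    obtain ⟨y, rfl⟩ := E.toConj.surjective g
    rw [conjOperator_toConj, conjOperator_toConj, ContinuousLinearMap.adjoint_adjoint]
    exact hL.adjoint_comp x y
  exists_commutator f := by
    obtain ⟨x, rfl⟩ := E.toConj.surjective f
    exact ⟨_, hL.isCommutator_conj x⟩
  even_iff := hL.even_iff.symm
  map_grading γ hγ γ' hγ' f := by
    obtain ⟨x, rfl⟩ := E.toConj.surjective f
    have h := congrArg adjoint (hL.map_grading γ' hγ' γ hγ x)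
    rw [ContinuousLinearMap.adjoint_comp, ContinuousLinearMap.adjoint_comp,
      (τ.grading_star γ hγ).adjoint_eq, (σ.grading_star γ' hγ').adjoint_eq] at h
    exact h.symm

end Conjugate

section Composition

open AlgBimodule

variable {σ τ ρ : UnitalSpectralTriple.{u, v}} {E : AlgBimodule τ.A σ.A}
  {F : AlgBimodule ρ.A τ.A}

/-- The map `x₂ ⊗ x₁ ↦ L₂ x₂ ∘ L₁ x₁`. -/
noncomputable def tensorOperator (L₂ : F →ₗ[ℂ] τ.H →L[ℂ] ρ.H) (L₁ : E →ₗ[ℂ] σ.H →L[ℂ] τ.H)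
    (h₂ : ∀ x b, L₂ (op b • x) = L₂ x ∘L τ.rep b) (h₁ : ∀ b x, L₁ (b • x) = τ.rep b ∘L L₁ x) :
    F.tensor E →ₗ[ℂ] σ.H →L[ℂ] ρ.H :=
  tensorLift
    (LinearMap.mk₂ ℂ (fun x y => L₂ x ∘L L₁ y)
      (fun x x' y => by rw [map_add, ContinuousLinearMap.add_comp])
      (fun c x y => by rw [map_smul, ContinuousLinearMap.smul_comp])
      (fun x y y' => by rw [map_add, ContinuousLinearMap.comp_add])
      (fun c x y => by rw [map_smul, ContinuousLinearMap.comp_smul]))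
    fun x b y => by
      simp only [LinearMap.mk₂_apply]
      rw [h₂, h₁, ContinuousLinearMap.comp_assoc]

theorem tensorOperator_tmul (L₂ : F →ₗ[ℂ] τ.H →L[ℂ] ρ.H) (L₁ : E →ₗ[ℂ] σ.H →L[ℂ] τ.H)
    (h₂ : ∀ x b, L₂ (op b • x) = L₂ x ∘L τ.rep b) (h₁ : ∀ b x, L₁ (b • x) = τ.rep b ∘L L₁ x)
    (x : F) (y : E) : tensorOperator L₂ L₁ h₂ h₁ (tmul x y) = L₂ x ∘L L₁ y := by
  rw [tensorOperator, tensorLift_tmul, LinearMap.mk₂_apply]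

theorem IsDiracRepresentation.tensor {K₂ : EquivalenceBimodule F} {K₁ : EquivalenceBimodule E}
    {L₂ : F →ₗ[ℂ] τ.H →L[ℂ] ρ.H} {L₁ : E →ₗ[ℂ] σ.H →L[ℂ] τ.H}
    (h₂ : IsDiracRepresentation K₂ L₂) (h₁ : IsDiracRepresentation K₁ L₁) :
    IsDiracRepresentation (K₂.tensor K₁)
      (tensorOperator L₂ L₁ h₂.map_right h₁.map_left) where
  map_right x a := by
    induction x using tensor_induction with
    | tmul x₂ x₁ =>
      rw [op_smul_tmul, tensorOperator_tmul, tensorOperator_tmul, h₁.map_right,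
        ContinuousLinearMap.comp_assoc]
    | add s t hs ht => rw [smul_add, map_add, map_add, hs, ht, ContinuousLinearMap.add_comp]
  map_left c x := by
    induction x using tensor_induction with
    | tmul x₂ x₁ =>
      rw [smul_tmul, tensorOperator_tmul, tensorOperator_tmul, h₂.map_left,
        ContinuousLinearMap.comp_assoc]
    | add s t hs ht => rw [smul_add, map_add, map_add, hs, ht, ContinuousLinearMap.comp_add]
  adjoint_comp x y := by
    induction x using tensor_induction with
    | tmul x₂ x₁ =>
      induction y using tensor_induction with
      | tmul y₂ y₁ =>
        have h : (K₂.tensor K₁).right.inner (tmul x₂ x₁) (tmul y₂ y₁)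
            = K₁.right.inner x₁ (K₂.right.inner x₂ y₂ • y₁) :=
          FiniteKasparov.tensor_inner_tmul_tmul ..
        rw [h, ← h₁.adjoint_comp, h₁.map_left, ← h₂.adjoint_comp, tensorOperator_tmul,
          tensorOperator_tmul, ContinuousLinearMap.adjoint_comp]
        rfl
      | add s t hs ht => rw [map_add, ContinuousLinearMap.comp_add, hs, ht, map_add, map_add]
    | add s t hs ht =>
      rw [map_add, map_add, ContinuousLinearMap.add_comp, hs, ht, FiniteKasparov.inner_add_left,
        map_add]
  comp_adjoint x y := by
    induction x using tensor_induction with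
    | tmul x₂ x₁ =>
      induction y using tensor_induction with
      | tmul y₂ y₁ =>
        let b := K₁.left.inner (E.toConj x₁) (E.toConj y₁)
        have h : (K₂.tensor K₁).left.inner ((F.tensor E).toConj (tmul x₂ x₁))
            ((F.tensor E).toConj (tmul y₂ y₁))
            = K₂.left.inner (F.toConj x₂) (F.toConj (op (star b) • y₂)) := by
          change (K₁.left.tensor K₂.left).inner
            (tensorConj F E ((F.tensor E).toConj (tmul x₂ x₁)))
            (tensorConj F E ((F.tensor E).toConj (tmul y₂ y₁))) = _
          rw [tensorConj_toConj_tmul, tensorConj_toConj_tmul,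
            FiniteKasparov.tensor_inner_tmul_tmul, toConj_op_smul, star_star]
        rw [h, ← h₂.comp_adjoint, h₂.map_right, tensorOperator_tmul, tensorOperator_tmul,
          ContinuousLinearMap.adjoint_comp, ContinuousLinearMap.adjoint_comp,
          ← ContinuousLinearMap.star_eq_adjoint (τ.rep _), map_star, star_star,
          ← h₁.comp_adjoint]
        rfl
      | add s t hs ht =>
        rw [map_add, map_add, ContinuousLinearMap.comp_add, hs, ht, map_add, map_add, map_add]
    | add s t hs ht =>
      rw [map_add, ContinuousLinearMap.add_comp, hs, ht, map_add, FiniteKasparov.inner_add_left,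
        map_add]
  exists_commutator x := by
    induction x using tensor_induction with
    | tmul x₂ x₁ =>
      rw [tensorOperator_tmul]
      exact ⟨_, (h₂.isCommutator x₂).comp (h₁.isCommutator x₁)⟩
    | add s t hs ht =>
      obtain ⟨S, hS⟩ := hs
      obtain ⟨T, hT⟩ := ht
      rw [map_add]
      exact ⟨_, hS.add hT⟩
  even_iff := h₁.even_iff.trans h₂.even_iff
  map_grading γ hγ γ'' hγ'' x := by
    obtain ⟨γ', hγ'⟩ := Option.isSome_iff_exists.1
      (h₁.even_iff.1 (Option.isSome_iff_exists.2 ⟨γ, hγ⟩))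
    induction x using tensor_induction with
    | tmul x₂ x₁ =>
      rw [tensorOperator_tmul, ContinuousLinearMap.comp_assoc, h₁.map_grading γ hγ γ' hγ',
        ← ContinuousLinearMap.comp_assoc, h₂.map_grading γ' hγ' γ'' hγ'',
        ContinuousLinearMap.comp_assoc]
    | add s t hs ht =>
      rw [map_add, ContinuousLinearMap.add_comp, ContinuousLinearMap.comp_add, hs, ht]

end Composition

theorem spectralMoritaEquivalent_iff {σ τ : UnitalSpectralTriple.{u, v}} :
    SpectralMoritaEquivalent σ τ ↔ IsMoritaEquivalent ℂ σ.A τ.A ∧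
      ∃ (E : AlgBimodule τ.A σ.A) (K : EquivalenceBimodule E) (L : E →ₗ[ℂ] σ.H →L[ℂ] τ.H),
        IsDiracRepresentation K L := by
  refine and_congr_right fun _ => ⟨?_, ?_⟩
  · rintro ⟨E, K, C, U, hU⟩
    exact ⟨E, K, _, hU.isDiracRepresentation⟩
  · rintro ⟨E, K, L, hL⟩
    exact ⟨E, K, _, _, hL.isUnitaryEquivTwist⟩

theorem equivalence_spectralMoritaEquivalent :
    Equivalence (SpectralMoritaEquivalent :
      UnitalSpectralTriple.{u, v} → UnitalSpectralTriple.{u, v} → Prop) where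
  refl σ := spectralMoritaEquivalent_iff.2 ⟨.refl ℂ σ.A, _, _, _, σ.isDiracRepresentation_self⟩
  symm h := by
    obtain ⟨hA, E, K, L, hL⟩ := spectralMoritaEquivalent_iff.1 h
    exact spectralMoritaEquivalent_iff.2 ⟨hA.symm, _, _, _, hL.conj⟩
  trans h h' := by
    obtain ⟨hA, E, K, L, hL⟩ := spectralMoritaEquivalent_iff.1 h
    obtain ⟨hA', E', K', L', hL'⟩ := spectralMoritaEquivalent_iff.1 h'
    exact spectralMoritaEquivalent_iff.2 ⟨hA.trans ℂ hA', _, _, _, hL'.tensor hL⟩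

end Equivalence

theorem mainTheorem9 :
    Equivalence (SpectralMoritaEquivalent :
      UnitalSpectralTriple.{u, v} → UnitalSpectralTriple.{u, v} → Prop) ∧
    ∀ (σ τ : UnitalSpectralTriple.{u, v}) (E : AlgBimodule τ.A σ.A) (K : EquivalenceBimodule E)
      (C : SigmaConnection σ K.right) (U : BalTensor E σ.actH ≃ₗ[ℂ] τ.H),
      IsUnitaryEquivTwist σ τ C U →
      ∃ (V : BalTensor E.conj τ.actH ≃ₗ[ℂ] σ.H) (C' : SigmaConnection τ K.left),
        (∀ (x ξ : E) (h : σ.H),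
          V (BalTensor.tmul τ.actH (E.toConj x) (U (BalTensor.tmul σ.actH ξ h)))
            = σ.rep (K.right.inner x ξ) h) ∧
        (∀ (x ξ : E) (h : σ.H),
          V (τ.eval (U (BalTensor.tmul σ.actH ξ h)) (C'.nabla (E.toConj x)))
            = - (σ.pairing K.right x (C.nabla ξ) : σ.H →L[ℂ] σ.H) h
              + (σ.commutator (K.right.inner x ξ) : σ.H →L[ℂ] σ.H) h) ∧
        IsUnitaryEquivTwist τ σ C' V := by
  refine ⟨equivalence_spectralMoritaEquivalent, fun σ τ E K C U hU => ?_⟩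
  have hL := hU.isDiracRepresentation
  refine ⟨hL.conj.applyEquiv, hL.conj.connection, fun x ξ h => ?_, fun x ξ h => ?_,
    hL.conj.isUnitaryEquivTwist⟩
  · rw [hL.conj.applyEquiv_tmul, conjOperator_toConj, hU.adjoint_creation]
  · -- Both sides are computed from the commutators of `(L x)*`, `L ξ` and `(L x)* L ξ = (x, ξ)`.
    have hcomm := (hL.isCommutator_conj x).comp (hL.isCommutator ξ)
    rw [conjOperator_toConj, hL.adjoint_comp] at hcomm
    refine (hL.conj.applyEquiv_eval _ _).trans ?_
    rw [hL.conj.commutator_eq (hL.isCommutator_conj x), σ.commutator_eq hcomm,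
      coe_pairing hU.creation hL.map_right hL.adjoint_comp, ← hU.commutator_creation]
    change _ = -(ContinuousLinearMap.adjoint (hU.creation x)) (hL.commutator ξ h)
      + (_ + (ContinuousLinearMap.adjoint (hU.creation x)) (hL.commutator ξ h))
    rw [neg_add_cancel_comm_assoc]
    rfl
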